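/- All graphs are finite, undirected and simple. For a graph $G$ and $S\subseteq V(G)$ with $|S|\ge 2$, an $S$-tree is a subgraph $T$ of $G$ that is a tree with $S\subseteq V(T)$; two $S$-trees $T,T'$ are internally disjoint if $E(T)\cap E(T')=\varnothing$ and $V(T)\cap V(T')=S$; $\kappa(S)$ is the maximum number of pairwise internally disjoint $S$-trees in $G$. For a connected graph $G$ with at least three vertices, $\kappa_3(G)=\min\{\kappa(S): S\subseteq V(G),\ |S|=3\}$; for a connected graph with fewer than three vertices $\kappa_3(G)=1$, and for a disconnected graph $\kappa_3(G)=0$. Let $\kappa(G)$ be the vertex-connectivity (the minimum number of vertices whose removal leaves a graph that is disconnected or has at most one vertex), $\delta(G)$ the minimum degree, and $G\Box H$ the Cartesian product. **Theorem.** Let $G$ and $H$ be connected graphs, not both consisting of a single vertex. Let $r_1,r_2\in\{0,1,2,3\}$ with $r_1\equiv\kappa(G)$ and $r_2\equiv\kappa(H)\pmod 4$. Then $$\kappa_3(G\Box H)\le\min\Big\{\big\lfloor\tfrac43\kappa_3(G)+r_1-\tfrac43\lceil\tfrac{r_1}{2}\rceil\big\rfloor\,|V(H)|,\ \big\lfloor\tfrac43\kappa_3(H)+r_2-\tfrac43\lceil\tfrac{r_2}{2}\rceil\big\rfloor\,|V(G)|,\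 \delta(G)+\delta(H)\Big\}.$$ Moreover, the bound is sharp: for every $N$ there are connected graphs $G$ and $H$, each with at least $N$ vertices, for which equality holds. -/

import Mathlib

namespace GenConn

/-- `T` is an `S`-Steiner tree of `G`: a subgraph that is a tree and contains all vertices of `S`. -/
def IsSteinerTree {V : Type*} (G : SimpleGraph V) (S : Set V) (T : G.Subgraph) : Prop :=
  T.coe.IsTree ∧ S ⊆ T.verts

/-- Two `S`-trees are internally disjoint: no common edge, and exactly `S` as common vertices. -/
def InternallyDisjoint {V : Type*} {G : SimpleGraph V} (S : Set V) (T T' : G.Subgraph) : Prop :=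
  T.edgeSet ∩ T'.edgeSet = ∅ ∧ T.verts ∩ T'.verts = S

/-- The generalized local connectivity `κ(S)`: the maximum number of pairwise internally disjoint
`S`-trees in `G` (for a finite graph the set below is nonempty and bounded). -/
noncomputable def localConn {V : Type*} (G : SimpleGraph V) (S : Set V) : ℕ :=
  sSup {n : ℕ | ∃ F : Finset G.Subgraph, F.card = n ∧ (∀ T ∈ F, IsSteinerTree G S T) ∧
    ∀ T ∈ F, ∀ T' ∈ F, T ≠ T' → InternallyDisjoint S T T'}

open Classical in
/-- The generalized `k`-connectivity `κ_k(G)`: the minimum of `κ(S)` over all vertex sets `S` of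
size `k`, with the conventions `κ_k(G) = 1` if `G` is connected with fewer than `k` vertices, and
`κ_k(G) = 0` if `G` is disconnected. -/
noncomputable def genConn {V : Type*} (k : ℕ) (G : SimpleGraph V) : ℕ :=
  if G.Connected then
    if Nat.card V < k then 1
    else sInf {n : ℕ | ∃ S : Finset V, S.card = k ∧ localConn G (S : Set V) = n}
  else 0

/-- The (vertex-)connectivity `κ(G)` of a finite graph: the minimum number of vertices whose
removal leaves a graph that is disconnected or has at most one vertex. -/
noncomputable def vertexConn {V : Type*} (G : SimpleGraph V) : ℕ :=
  sInf {n : ℕ | ∃ X : Finset V, X.card = n ∧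
    (¬ (G.induce ((X : Set V)ᶜ)).Preconnected ∨ ((X : Set V)ᶜ).Subsingleton)}

/-- `⌊(4/3) κ₃(G) + r - (4/3) ⌈r/2⌉⌋`, where `r ∈ {0, 1, 2, 3}` and `r ≡ κ(G) (mod 4)`. -/
noncomputable def coeff {V : Type*} (G : SimpleGraph V) : ℤ :=
  ⌊(4 / 3 : ℚ) * (genConn 3 G : ℚ) + ((vertexConn G % 4 : ℕ) : ℚ)
    - (4 / 3 : ℚ) * ((⌈((vertexConn G % 4 : ℕ) : ℚ) / 2⌉ : ℤ) : ℚ)⌋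

/-- `min {⌊(4/3) κ₃(G) + r₁ - (4/3) ⌈r₁/2⌉⌋ |V(H)|, ⌊(4/3) κ₃(H) + r₂ - (4/3) ⌈r₂/2⌉⌋ |V(G)|,
δ(G) + δ(H)}`. -/
noncomputable def upperBound {V W : Type*} [Fintype V] [Fintype W]
    (G : SimpleGraph V) (H : SimpleGraph W) [DecidableRel G.Adj] [DecidableRel H.Adj] : ℤ :=
  min (coeff G * (Fintype.card W : ℤ))
    (min (coeff H * (Fintype.card V : ℤ)) ((G.minDegree : ℤ) + (H.minDegree : ℤ)))

end GenConn

/-! The fibres over a minimum cut of `G` form a cut of `G □ H`, so `κ₃(G □ H) ≤ κ(G)|V(H)|`, and it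
suffices that the coefficient of `|V(H)|` is at least `κ(G)`. Writing `κ(G) = 4q + r`, this amounts
to `κ₃(G) ≥ 3q + ⌈r/2⌉ = ⌊(3κ(G)+1)/4⌋` (`vertexConn_le_genConn`, `le_coeff`). The degree bound
holds because edge-disjoint trees use distinct edges at a terminal; it also covers one-vertex
factors and factors whose minimum "cut" leaves at most one vertex.

The core is the lower bound on `κ₃`. In the barycentric subdivision the terminals `a, b, c` are
pairwise nonadjacent, and sets that meet only in terminals yield edge-disjoint subgraphs; `k = κ(G)`
still bounds separators of two original vertices (`subdivision_unseparated`). Take `k` disjoint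
`a`–`b` paths and grow a fan of `k` links from `c` towards the neighbours of `a`, the neighbours of
`b` and these paths, by a Menger augmentation that never gives up an end already reached
(`IsLinkage.augment`). Whenever a second link arrives on the same path, that path is used up: one
link follows it to `a`, the other to `b` (`MixedSystem.release`).

If `s` paths are used up in the end, there are `k - s` paths, `s` links to `a`, `s` links to `b`,
and `k - 2s` links each assigned to a path of its own. The last kind gives `k - 2s` connectors.
Among the rest, a spare path with any link is a connector, and so is a link to `a` with a link to
`b`. With `m = ⌊s/2⌋` this gives `k - s + m` connectors, at least `⌊(3k+1)/4⌋` since `2s ≤ k`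
(`MixedSystem.exists_connectors`).

For sharpness both factors are a complete graph with a pendant vertex, so the degree sum is 2. Two
disjoint trees for every `S` come from a 2-colouring of the product with connected colour classes,
in which every vertex has a neighbour (its mate) of the other colour; a vertex of `S` joins the
opposite class through its mate. -/

/-- `l` is a path of `H` that starts in `A`, ends in `e`, and meets `B` in `e` only. -/
def IsLink {V : Type*} (H : SimpleGraph V) (A B : Set V) (l : List V) (e : V) : Prop :=
  l.IsChain H.Adj ∧ l.Nodup ∧ (∃ x ∈ A, l.head? = some x) ∧ l.getLast? = some e ∧
    ∀ x ∈ l, x ∈ B ↔ x = e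

/-- The family `p` consists of disjoint links from `A` to the points of `E`. -/
def IsLinkage {V : Type*} (H : SimpleGraph V) (A B : Set V) (E : Finset V) (p : V → List V) :
    Prop :=
  (∀ e ∈ E, IsLink H A B (p e) e) ∧ ∀ e ∈ E, ∀ f ∈ E, e ≠ f → (p e).Disjoint (p f)

/-- Some point of `B` can be reached from `A` outside `Z`. -/
def Unseparated {V : Type*} (H : SimpleGraph V) (A B : Set V) (Z : Finset V) : Prop :=
  ∃ x ∈ A, ∃ y ∈ B, x ∉ Z ∧ Relation.ReflTransGen (fun u v => H.Adj u v ∧ v ∉ Z) x y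

/-! ### Links: concatenation, truncation, existence -/

section Linkage

variable {V : Type*} {H : SimpleGraph V} {A B B' : Set V} {E E' : Finset V}

theorem IsLink.mem_last {l : List V} {e : V} (h : IsLink H A B l e) : e ∈ l :=
  List.mem_of_getLast? h.2.2.2.1

theorem IsLink.last_mem {l : List V} {e : V} (h : IsLink H A B l e) : e ∈ B :=
  (h.2.2.2.2 e h.mem_last).2 rfl

theorem IsLink.exists_cons {l : List V} {e : V} (h : IsLink H A B l e) :
    ∃ x ∈ A, ∃ t, l = x :: t := by
  obtain ⟨x, hx, hl⟩ := h.2.2.1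
  exact ⟨x, hx, _, (List.cons_head?_tail hl).symm⟩

/-- A linkage onto `E'` can be continued by disjoint links from `E'` to `E`. -/
theorem IsLinkage.comp {p q : V → List V} (hp : IsLinkage H A B' E' p) (hB : B ⊆ B')
    (hq : IsLinkage H (E' : Set V) B E q) (hqB : ∀ e ∈ E, ∀ x ∈ q e, x ∈ B') :
    ∃ r, IsLinkage H A B E r := by
  have hcons : ∀ e : V, ∃ ht : V × List V, e ∈ E → ht.1 ∈ E' ∧ q e = ht.1 :: ht.2 := by
    intro e
    by_cases he : e ∈ E
    · obtain ⟨x, hx, t, ht⟩ := (hq.1 e he).exists_cons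
      exact ⟨(x, t), fun _ => ⟨hx, ht⟩⟩
    · exact ⟨(e, []), fun h => absurd h he⟩
  choose ht hht using hcons
  -- The head of `q e` is already the last vertex of the link before it, so only the tail is
  -- appended.
  refine ⟨fun e => p (ht e).1 ++ (ht e).2, ?_, ?_⟩
  · intro e he
    obtain ⟨hh, hqe⟩ := hht e he
    obtain ⟨pc, pn, ⟨x, hxA, pxh⟩, pl, pB⟩ := hp.1 _ hh
    obtain ⟨qc, qn, -, ql, qB⟩ := hq.1 e he
    have hqB := hqB e he
    rw [hqe] at qc qn ql qB hqB
    rw [List.isChain_cons] at qc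
    rw [List.nodup_cons] at qn
    refine ⟨?_, ?_, ⟨x, hxA, ?_⟩, ?_, ?_⟩
    · refine List.isChain_append.2 ⟨pc, qc.2, ?_⟩
      intro u hu v hv
      rw [pl] at hu
      simp only [Option.mem_def, Option.some.injEq] at hu
      subst hu
      exact qc.1 v hv
    · refine List.nodup_append'.2 ⟨pn, qn.2, ?_⟩
      intro y hy hy'
      have := (pB y hy).1 (hqB y (List.mem_cons_of_mem _ hy'))
      subst this
      exact qn.1 hy'
    · simp [List.head?_append, pxh]
    · rw [List.getLast?_cons] at ql
      rw [List.getLast?_append, pl]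
      cases h : (ht e).2.getLast? <;> simp_all
    · intro y hy
      rcases List.mem_append.1 hy with hy | hy
      · constructor
        · intro hyB
          have := (pB y hy).1 (hB hyB)
          subst this
          exact (qB _ List.mem_cons_self).1 hyB
        · rintro rfl
          exact (hq.1 y he).last_mem
      · exact qB y (List.mem_cons_of_mem _ hy)
  · intro e he f hf hef y hy hy'
    obtain ⟨hh, hqe⟩ := hht e he
    obtain ⟨hh', hqf⟩ := hht f hf
    have hdis := hq.2 e he f hf hef
    have hqBe := hqB e he
    have hqBf := hqB f hf
    rw [hqe] at hdis hqBe
    rw [hqf] at hdis hqBf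
    rcases List.mem_append.1 hy with hy | hy <;> rcases List.mem_append.1 hy' with hy' | hy'
    · refine hp.2 _ hh _ hh' ?_ hy hy'
      intro heq
      exact hdis List.mem_cons_self (heq ▸ List.mem_cons_self)
    · have := ((hp.1 _ hh).2.2.2.2 y hy).1 (hqBf y (List.mem_cons_of_mem _ hy'))
      subst this
      exact hdis List.mem_cons_self (List.mem_cons_of_mem _ hy')
    · have := ((hp.1 _ hh').2.2.2.2 y hy').1 (hqBe y (List.mem_cons_of_mem _ hy))
      subst this
      exact hdis (List.mem_cons_of_mem _ hy) List.mem_cons_self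
    · exact hdis (List.mem_cons_of_mem _ hy) (List.mem_cons_of_mem _ hy')

theorem IsLink.singleton {e : V} (hA : e ∈ A) (hB : e ∈ B) : IsLink H A B [e] e :=
  ⟨List.isChain_singleton _, by simp, ⟨e, hA, rfl⟩, rfl, by simp [hB]⟩

/-- The part of a link after one of its vertices. -/
theorem IsLink.suffix {l₁ l₂ : List V} {x e : V} (h : IsLink H A B (l₁ ++ x :: l₂) e)
    {A' : Set V} (hx : x ∈ A') : IsLink H A' B (x :: l₂) e := by
  obtain ⟨hc, hn, -, hl, hB⟩ := h
  refine ⟨hc.right_of_append, (List.nodup_append'.1 hn).2.1, ⟨x, hx, rfl⟩, ?_, fun y hy =>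
    hB y (List.mem_append_right _ hy)⟩
  rw [List.getLast?_append] at hl
  rw [List.getLast?_cons] at hl ⊢
  simpa using hl

/-- The walk is turned into a path from its end backwards: restart at a vertex of `B`, and cut off
the loop at a repeated vertex. -/
theorem Unseparated.exists_isLink {Z : Finset V} (h : Unseparated H A B Z) :
    ∃ l e, IsLink H A B l e ∧ ∀ x ∈ l, x ∉ Z := by
  obtain ⟨x, hx, y, hy, hxZ, hxy⟩ := h
  suffices ∃ l e, IsLink H {x} B l e ∧ ∀ z ∈ l, z ∉ Z by
    obtain ⟨l, e, ⟨h1, h2, ⟨z, hz, h3⟩, h4⟩, hl⟩ := this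
    rw [Set.mem_singleton_iff] at hz
    exact ⟨l, e, ⟨h1, h2, ⟨z, hz ▸ hx, h3⟩, h4⟩, hl⟩
  clear hx
  induction hxy using Relation.ReflTransGen.head_induction_on with
  | refl => exact ⟨[y], y, IsLink.singleton rfl hy, by simpa using hxZ⟩
  | @head u v huv _ ih =>
    by_cases hu : u ∈ B
    · exact ⟨[u], u, IsLink.singleton rfl hu, by simpa using hxZ⟩
    obtain ⟨l, e, hl, hZ⟩ := ih huv.2
    by_cases hul : u ∈ l
    · obtain ⟨l₁, l₂, rfl⟩ := List.append_of_mem hul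
      exact ⟨_, e, hl.suffix rfl, fun z hz => hZ z (List.mem_append_right _ hz)⟩
    · obtain ⟨w, hw, t, rfl⟩ := hl.exists_cons
      rw [Set.mem_singleton_iff] at hw
      subst hw
      obtain ⟨h1, h2, -, h4, h5⟩ := hl
      refine ⟨u :: w :: t, e, ⟨List.isChain_cons_cons.2 ⟨huv.1, h1⟩, List.nodup_cons.2 ⟨hul, h2⟩,
        ⟨u, rfl, rfl⟩, ?_, ?_⟩, ?_⟩
      · simpa using h4
      · intro z hz
        rcases List.mem_cons.1 hz with rfl | hz
        · refine ⟨fun h => absurd h hu, ?_⟩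
          rintro rfl
          exact absurd (List.mem_of_getLast? h4) hul
        · exact h5 z hz
      · intro z hz
        rcases List.mem_cons.1 hz with rfl | hz
        · exact hxZ
        · exact hZ z hz

theorem exists_last_mem {l : List V} {P : V → Prop} (h : ∃ x ∈ l, P x) :
    ∃ l₁ x l₂, l = l₁ ++ x :: l₂ ∧ P x ∧ ∀ y ∈ l₂, ¬ P y := by
  induction l with
  | nil => simp at h
  | cons a l ih =>
    by_cases hl : ∃ x ∈ l, P x
    · obtain ⟨l₁, x, l₂, rfl, h1, h2⟩ := ih hl
      exact ⟨a :: l₁, x, l₂, rfl, h1, h2⟩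
    · push Not at hl
      refine ⟨[], a, l, rfl, ?_, hl⟩
      obtain ⟨x, hx, hP⟩ := h
      rcases List.mem_cons.1 hx with rfl | hx
      · exact hP
      · exact absurd hP (hl x hx)

end Linkage

/-! ### Menger's theorem by augmentation, keeping the ends -/

section Augment

variable {V : Type*} {H : SimpleGraph V} {A : Set V}

theorem IsLink.split {B : Set V} {l₁ l₂ : List V} {x e : V} (h : IsLink H A B (l₁ ++ x :: l₂) e) :
    l₁.Disjoint (x :: l₂) ∧ x ∉ l₂ := by
  have := List.nodup_append'.1 h.2.1
  exact ⟨this.2.2, (List.nodup_cons.1 this.2.1).1⟩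

/-- A link cut short at one of its vertices. -/
theorem IsLink.prefix {B B' : Set V} {l₁ l₂ : List V} {x e : V}
    (h : IsLink H A B (l₁ ++ x :: l₂) e) (hx : ∀ y ∈ l₁ ++ [x], y ∈ B' ↔ y = x) :
    IsLink H A B' (l₁ ++ [x]) x := by
  obtain ⟨hc, hn, ⟨a, ha, hh⟩, hl, hB⟩ := h
  have e1 : l₁ ++ x :: l₂ = (l₁ ++ [x]) ++ l₂ := by simp
  rw [e1] at hc hn
  refine ⟨hc.left_of_append, (List.nodup_append'.1 hn).1, ⟨a, ha, ?_⟩, by simp, hx⟩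
  simpa [List.head?_append] using hh

open Classical in
/-- A linkage that fails to be maximal can be enlarged by one link, keeping its end points. -/
theorem IsLinkage.augment (n : ℕ) : ∀ (B : Set V) (E : Finset V) (p : V → List V),
    IsLinkage H A B E p → ∑ e ∈ E, (p e).length ≤ n →
    (∀ Z : Finset V, Z.card ≤ E.card → Unseparated H A B Z) →
    ∃ y, y ∉ E ∧ ∃ q, IsLinkage H A B (insert y E) q := by
  induction n with
  | zero =>
    intro B E p hp hn hsep
    have hE : E = ∅ := by
      by_contra hne
      obtain ⟨e, he⟩ := Finset.nonempty_of_ne_empty hne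
      have h1 := Finset.single_le_sum (f := fun e => (p e).length) (fun _ _ => Nat.zero_le _) he
      have h2 := List.length_pos_of_mem (hp.1 e he).mem_last
      omega
    subst hE
    obtain ⟨l, e, hl, -⟩ := (hsep ∅ le_rfl).exists_isLink
    exact ⟨e, by simp, fun _ => l, by simpa using hl, by simp +contextual⟩
  | succ n ih =>
    intro B E p hp hn hsep
    -- The set of ends `E` is itself too small to separate, so some path `R` reaches `B` at a new
    -- point and avoids every old end.
    obtain ⟨R, r, hR, hRE⟩ := (hsep E le_rfl).exists_isLink
    have hrE : r ∉ E := hRE r hR.mem_last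
    by_cases hmeet : ∃ x ∈ R, ∃ e ∈ E, x ∈ p e
    swap
    · refine ⟨r, hrE, fun e => if e = r then R else p e, ?_, ?_⟩
      · intro e he
        rcases Finset.mem_insert.1 he with rfl | he
        · simpa using hR
        · have : e ≠ r := fun h => hrE (h ▸ he)
          simpa [this] using hp.1 e he
      · intro e he f hf hef
        rcases Finset.mem_insert.1 he with rfl | he' <;> rcases Finset.mem_insert.1 hf with rfl | hf'
        · exact absurd rfl hef
        · have : f ≠ e := hef.symm
          simp only [if_true, this, if_false]
          exact fun y hy hy' => hmeet ⟨y, hy, f, hf', hy'⟩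
        · simp only [if_true, hef, if_false]
          exact fun y hy hy' => hmeet ⟨y, hy', e, he', hy⟩
        · have h1 : f ≠ r := fun h => hrE (h ▸ hf')
          have h2 : e ≠ r := fun h => hrE (h ▸ he')
          simpa [h1, h2] using hp.2 e he' f hf' hef
    -- `x` is the last vertex of `R` on any link; it splits that link as `u, x, v`, and the rest `w`
    -- of `R` meets no link.
    obtain ⟨R₁, x, w, hReq, ⟨e₁, he₁, hx₁⟩, hw⟩ := exists_last_mem hmeet
    obtain ⟨u, v, hpe⟩ := List.append_of_mem hx₁
    subst hReq
    have hp1 := hp.1 e₁ he₁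
    rw [hpe] at hp1
    have hxe : x ≠ e₁ := by
      rintro rfl
      exact hRE x (by simp) he₁
    have hxB : x ∉ B := fun h => hxe ((hp1.2.2.2.2 x (by simp)).1 h)
    have hxE : x ∉ E := fun h => hxB (hp.1 x h).last_mem
    have hlv := (hp1.suffix (A' := {x}) rfl)
    have hlw := (hR.suffix (A' := {x}) rfl)
    have he₁v : e₁ ∈ v := (List.mem_cons.1 hlv.mem_last).resolve_left hxe.symm
    have hrx : r ≠ x := fun h => hxB (h ▸ hR.last_mem)
    have hrw : r ∈ w := (List.mem_cons.1 hlw.mem_last).resolve_left hrx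
    obtain ⟨hdu, hxv⟩ := hp1.split
    obtain ⟨-, hxw⟩ := hR.split
    have hvw : ∀ y ∈ v, y ∉ w := fun y hy hyw => hw y hyw ⟨e₁, he₁, by rw [hpe]; simp [hy]⟩
    -- The target absorbs both ways on from `x`: along the old link (`v`) and along `R` (`w`). The
    -- link through `x` may then stop at `x`, which shortens the system and allows induction.
    set B' : Set V := B ∪ {y | y = x ∨ y ∈ v ∨ y ∈ w} with hB'
    have hBB' : B ⊆ B' := Set.subset_union_left
    set E' : Finset V := insert x (E.erase e₁) with hE'
    have hcard : E'.card = E.card := by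
      rw [hE', Finset.card_insert_of_notMem (fun h => hxE (Finset.mem_of_mem_erase h)),
        Finset.card_erase_of_mem he₁]
      have := Finset.card_pos.2 ⟨e₁, he₁⟩
      omega
    have hne : ∀ e ∈ E.erase e₁, e ≠ x := fun e he h => hxE (h ▸ Finset.mem_of_mem_erase he)
    set p' : V → List V := fun e => if e = x then u ++ [x] else p e with hp'
    have hlink' : IsLinkage H A B' E' p' := by
      have hux : ∀ y ∈ u ++ [x], y ∈ p e₁ := by
        intro y hy
        rw [hpe]
        rcases List.mem_append.1 hy with hy | hy
        · simp [hy]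
        · simp only [List.mem_singleton] at hy
          simp [hy]
      constructor
      · intro e he
        rcases Finset.mem_insert.1 he with rfl | he
        · simp only [hp', if_true]
          refine hp1.prefix fun y hy => ⟨?_, ?_⟩
          · rintro (hyB | rfl | hyv | hyw)
            · have := (hp1.2.2.2.2 y (hpe ▸ hux y hy)).1 hyB
              subst this
              rcases List.mem_append.1 hy with hy | hy
              · exact absurd (List.mem_cons_of_mem _ he₁v) (fun h => hdu hy h)
              · simpa using hy
            · rfl
            · rcases List.mem_append.1 hy with hy | hy
              · exact absurd (List.mem_cons_of_mem _ hyv) (fun h => hdu hy h)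
              · simpa using hy
            · exact absurd ⟨e₁, he₁, hux y hy⟩ (hw y hyw)
          · rintro rfl
            exact Or.inr (Or.inl rfl)
        · have hex := hne e he
          have heE := Finset.mem_of_mem_erase he
          have hee := Finset.ne_of_mem_erase he
          simp only [hp', if_neg hex]
          obtain ⟨c1, c2, c3, c4, c5⟩ := hp.1 e heE
          have hd := hp.2 e heE e₁ he₁ hee
          rw [hpe] at hd
          refine ⟨c1, c2, c3, c4, fun y hy => ⟨?_, fun h => hBB' ((c5 y hy).2 h)⟩⟩
          rintro (hyB | rfl | hyv | hyw)
          · exact (c5 y hy).1 hyB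
          · exact absurd (show y ∈ u ++ y :: v by simp) (fun h => hd hy h)
          · exact absurd (show y ∈ u ++ x :: v by simp [hyv]) (fun h => hd hy h)
          · exact absurd ⟨e, heE, hy⟩ (hw y hyw)
      · have key : ∀ f ∈ E.erase e₁, (p' x).Disjoint (p' f) := by
          intro f hf
          simp only [hp', if_true, if_neg (hne f hf)]
          intro y hy hy'
          exact hp.2 f (Finset.mem_of_mem_erase hf) e₁ he₁ (Finset.ne_of_mem_erase hf) hy' (hux y hy)
        intro e he f hf hef
        rcases Finset.mem_insert.1 he with rfl | he' <;> rcases Finset.mem_insert.1 hf with rfl | hf'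
        · exact absurd rfl hef
        · exact key f hf'
        · exact (key e he').symm
        · simp only [hp', if_neg (hne f hf'), if_neg (hne e he')]
          exact hp.2 e (Finset.mem_of_mem_erase he') f (Finset.mem_of_mem_erase hf') hef
    have hlen : ∑ e ∈ E', (p' e).length ≤ n := by
      rw [hE', Finset.sum_insert (fun h => hxE (Finset.mem_of_mem_erase h))]
      have h1 : ∑ e ∈ E.erase e₁, (p' e).length = ∑ e ∈ E.erase e₁, (p e).length :=
        Finset.sum_congr rfl fun e he => by simp only [hp', if_neg (hne e he)]
      have h2 := Finset.add_sum_erase E (fun e => (p e).length) he₁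
      -- `v` contains `e₁`, so the total length strictly drops.
      have h3 := List.length_pos_of_mem he₁v
      simp only [hpe, List.length_append, List.length_cons] at h2
      rw [h1]
      simp only [hp', if_true, List.length_append, List.length_cons, List.length_nil]
      omega
    have hsep' : ∀ Z : Finset V, Z.card ≤ E'.card → Unseparated H A B' Z := by
      intro Z hZ
      obtain ⟨a, ha, b, hb, h⟩ := hsep Z (hcard ▸ hZ)
      exact ⟨a, ha, b, hBB' hb, h⟩
    obtain ⟨y, hyE', q, hq⟩ := ih B' E' p' hlink' hlen hsep'
    have hyB' : y ∈ B' := (hq.1 y (Finset.mem_insert_self _ _)).last_mem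
    have hyx : y ≠ x := fun h => hyE' (h ▸ Finset.mem_insert_self _ _)
    have hyE : y ∉ E.erase e₁ := fun h => hyE' (Finset.mem_insert_of_mem h)
    -- the continuation of `q` from `insert y E'`
    have herase : ∀ e ∈ E.erase e₁, ∀ z, z = x ∨ z ∈ v ∨ z ∈ w → e ≠ z := by
      intro e he z hz h
      subst h
      have heE := Finset.mem_of_mem_erase he
      rcases hz with rfl | hz | hz
      · exact hxE heE
      · exact hp.2 e heE e₁ he₁ (Finset.ne_of_mem_erase he) (hp.1 e heE).mem_last
          (by rw [hpe]; simp [hz])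
      · exact hRE e (by simp [hz]) heE
    have hEB : ∀ e ∈ E, e ∈ B := fun e he => (hp.1 e he).last_mem
    -- it suffices to find disjoint continuations to `e₁` and a new point
    suffices hs : ∃ z l m, z ∉ E ∧ IsLink H {x, y} B l e₁ ∧ IsLink H {x, y} B m z ∧ l.Disjoint m ∧
        (∀ a ∈ l, a = x ∨ a ∈ v ∨ a ∈ w ∨ a = y) ∧ (∀ a ∈ m, a = x ∨ a ∈ v ∨ a ∈ w ∨ a = y) by
      obtain ⟨z, l, m, hz, hl, hm, hlm, hl', hm'⟩ := hs
      refine ⟨z, hz, hq.comp hBB'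
        (q := fun e => if e = e₁ then l else if e = z then m else [e]) ⟨?_, ?_⟩ ?_⟩
      · have hsub : ({x, y} : Set V) ⊆ ((insert y E' : Finset V) : Set V) := by
          rintro a (rfl | rfl) <;> simp [hE']
        have hmono : ∀ {l e}, IsLink H {x, y} B l e →
            IsLink H ((insert y E' : Finset V) : Set V) B l e :=
          fun ⟨c1, c2, ⟨a, ha, c3⟩, c4⟩ => ⟨c1, c2, ⟨a, hsub ha, c3⟩, c4⟩
        intro e he
        by_cases h1 : e = e₁
        · subst h1
          simpa using hmono hl
        by_cases h2 : e = z
        · subst h2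
          simpa [h1] using hmono hm
        have heE : e ∈ E := (Finset.mem_insert.1 he).resolve_left h2
        simp only [h1, h2, if_false]
        exact IsLink.singleton (by simp [hE', h1, heE]) (hEB e heE)
      · intro e he f hf hef
        have aux : ∀ e ∈ insert z E, e ≠ e₁ → e ≠ z → ∀ a, (a = x ∨ a ∈ v ∨ a ∈ w ∨ a = y) →
            e ≠ a := by
          intro e he h1 h2 a ha
          have : e ∈ E.erase e₁ := Finset.mem_erase.2 ⟨h1, (Finset.mem_insert.1 he).resolve_left h2⟩
          by_cases hay : a = y
          · rintro rfl
            exact hyE (hay ▸ this)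
          · refine herase e this a ?_
            tauto
        have hze : z ≠ e₁ := fun h => hz (h ▸ he₁)
        by_cases h1 : e = e₁
        · by_cases h2 : f = z
          · have : f ≠ e₁ := fun h => hef (h1.trans h.symm)
            simpa [h1, h2, hze] using hlm
          · have h3 : f ≠ e₁ := fun h => hef (h1.trans h.symm)
            simp only [h1, h2, h3, if_true, if_false]
            intro a ha ha'
            rw [List.mem_singleton] at ha'
            exact aux f hf h3 h2 a (hl' a ha) ha'.symm
        · by_cases h2 : e = z
          · by_cases h3 : f = e₁
            · simpa [h1, h2, h3, hze] using hlm.symm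
            · have h4 : f ≠ z := fun h => hef (h2.trans h.symm)
              simp only [h2, h3, h4, hze, if_true, if_false]
              intro a ha ha'
              rw [List.mem_singleton] at ha'
              exact aux f hf h3 h4 a (hm' a ha) ha'.symm
          · have key := aux e he h1 h2
            simp only [h1, h2, if_false]
            intro a ha ha'
            rw [List.mem_singleton] at ha
            split_ifs at ha' with h3 h4
            · exact key a (hl' a ha') ha.symm
            · exact key a (hm' a ha') ha.symm
            · rw [List.mem_singleton] at ha'
              exact hef (ha.symm.trans ha')
      · intro e he a ha
        have hyv : ∀ a, (a = x ∨ a ∈ v ∨ a ∈ w ∨ a = y) → a ∈ B' := by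
          rintro a (h | h | h | rfl)
          · exact Or.inr (Or.inl h)
          · exact Or.inr (Or.inr (Or.inl h))
          · exact Or.inr (Or.inr (Or.inr h))
          · exact hyB'
        split_ifs at ha with h3 h4
        · exact hyv a (hl' a ha)
        · exact hyv a (hm' a ha)
        · rw [List.mem_singleton] at ha
          subst ha
          exact hBB' (hEB a ((Finset.mem_insert.1 he).resolve_left h4))
    have hmono : ∀ {A' : Set V} {l e}, A' ⊆ {x, y} → IsLink H A' B l e → IsLink H {x, y} B l e :=
      fun hsub ⟨c1, c2, ⟨a, ha, c3⟩, c4⟩ => ⟨c1, c2, ⟨a, hsub ha, c3⟩, c4⟩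
    -- The ends `x` and `y` must be continued disjointly to `e₁` and a new point. If `y` is on `v`,
    -- it goes to `e₁` and `x` goes to `r` along `w`; otherwise `x` takes `v` to `e₁`, and `y` goes
    -- to `r` along `w` or already lies in `B`.
    by_cases hyv : y ∈ v
    · obtain ⟨v₁, v₂, rfl⟩ := List.append_of_mem hyv
      refine ⟨r, y :: v₂, x :: w, hrE, hmono (by simp) (hlv.suffix (l₁ := x :: v₁) (A' := {y}) rfl),
        hmono (by simp) hlw, ?_, ?_, ?_⟩
      · intro a ha ha'
        have hav : a ∈ v₁ ++ y :: v₂ := List.mem_append_right _ ha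
        rcases List.mem_cons.1 ha' with rfl | ha'
        · exact hxv hav
        · exact hvw a hav ha'
      · intro a ha
        exact Or.inr (Or.inl (List.mem_append_right _ ha))
      · intro a ha
        rcases List.mem_cons.1 ha with h | h <;> simp [h]
    by_cases hyw : y ∈ w
    · obtain ⟨w₁, w₂, rfl⟩ := List.append_of_mem hyw
      refine ⟨r, x :: v, y :: w₂, hrE, hmono (by simp) hlv, hmono (by simp)
        (hlw.suffix (l₁ := x :: w₁) (A' := {y}) rfl), ?_, ?_, ?_⟩
      · intro a ha ha'
        have haw : a ∈ w₁ ++ y :: w₂ := List.mem_append_right _ ha'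
        rcases List.mem_cons.1 ha with rfl | ha
        · exact hxw haw
        · exact hvw a ha haw
      · intro a ha
        rcases List.mem_cons.1 ha with h | h <;> simp [h]
      · intro a ha
        exact Or.inr (Or.inr (Or.inl (List.mem_append_right _ ha)))
    have hyB : y ∈ B := by
      rcases hyB' with h | h | h | h
      · exact h
      · exact absurd h hyx
      · exact absurd h hyv
      · exact absurd h hyw
    have hye : y ≠ e₁ := fun h => hyv (h ▸ he₁v)
    refine ⟨y, x :: v, [y], fun h => hyE (Finset.mem_erase.2 ⟨hye, h⟩), hmono (by simp) hlv,
      IsLink.singleton (by simp) hyB, ?_, ?_, ?_⟩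
    · simp [hyx, hyv]
    · intro a ha
      rcases List.mem_cons.1 ha with h | h <;> simp [h]
    · intro a ha
      rw [List.mem_singleton] at ha
      simp [ha]

end Augment

/-! ### Mixed systems: crossings together with a fan of links -/

/-- `l` is a path of `H` whose first vertex is its only one in `A` and whose last vertex is its
only one in `B`. -/
def IsCrossing {V : Type*} (H : SimpleGraph V) (A B : Set V) (l : List V) : Prop :=
  l.IsChain H.Adj ∧ l.Nodup ∧ l ≠ [] ∧ (∀ x ∈ l, x ∈ A ↔ l.head? = some x) ∧
    ∀ x ∈ l, x ∈ B ↔ l.getLast? = some x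

/-- Drop everything before the last vertex in `A`. -/
theorem IsLink.exists_isCrossing {V : Type*} {H : SimpleGraph V} {A B : Set V} {l : List V} {e : V}
    (h : IsLink H A B l e) : ∃ l', IsCrossing H A B l' ∧ ∀ x ∈ l', x ∈ l := by
  obtain ⟨a, ha, t, rfl⟩ := h.exists_cons
  obtain ⟨l₁, x, l₂, heq, hx, hl₂⟩ := exists_last_mem (P := (· ∈ A)) ⟨a, List.mem_cons_self, ha⟩
  rw [heq] at h ⊢
  obtain ⟨-, hn⟩ := h.split
  have h' := h.suffix hx
  refine ⟨x :: l₂, ⟨h'.1, h'.2.1, by simp, ?_, ?_⟩, fun y hy => List.mem_append_right _ hy⟩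
  · intro y hy
    rcases List.mem_cons.1 hy with rfl | hy
    · simp [hx]
    · have : x ≠ y := fun h => hn (h ▸ hy)
      simp [hl₂ y hy, this]
  · intro y hy
    rw [h'.2.2.2.2 y hy, h'.2.2.2.1]
    simp [eq_comm]

/-- Menger's theorem: augment `k` times, starting from the empty linkage. -/
theorem exists_linkage_of_unseparated {V : Type*} {H : SimpleGraph V} {A B : Set V} (k : ℕ)
    (hsep : ∀ Z : Finset V, Z.card < k → Unseparated H A B Z) :
    ∃ E p, E.card = k ∧ IsLinkage H A B E p := by
  classical
  induction k with
  | zero => exact ⟨∅, fun _ => [], rfl, by simp, by simp⟩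
  | succ k ih =>
    obtain ⟨E, p, hE, hp⟩ := ih fun Z hZ => hsep Z (by omega)
    obtain ⟨y, hy, q, hq⟩ := hp.augment _ B E p le_rfl fun Z hZ => hsep Z (by omega)
    exact ⟨insert y E, q, by rw [Finset.card_insert_of_notMem hy, hE], hq⟩

/-- A system of crossings `P j`, `j ∈ J`, from `A` to `B`, and of disjoint links from `C` that end
in `A` (for the ends in `Ea`), in `B` (for the ends in `Eb`), or, for the ends in `Er`, anywhere in
`A`, `B` or the crossings, at most one in each crossing. -/
structure MixedSystem {V : Type*} [DecidableEq V] (H : SimpleGraph V) (A B C : Set V)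
    (P : V → List V) (J Ea Eb Er : Finset V) : Prop where
  crossing : ∀ j ∈ J, IsCrossing H A B (P j)
  disjoint : ∀ i ∈ J, ∀ j ∈ J, i ≠ j → (P i).Disjoint (P j)
  subA : ∀ e ∈ Ea, e ∈ A
  subB : ∀ e ∈ Eb, e ∈ B
  disjAB : ∀ e ∈ Ea, e ∉ Eb
  disjAR : ∀ e ∈ Ea, e ∉ Er
  disjBR : ∀ e ∈ Eb, e ∉ Er
  card_eq : Ea.card = Eb.card
  notMemA : ∀ j ∈ J, ∀ x ∈ P j, x ∉ Ea
  notMemB : ∀ j ∈ J, ∀ x ∈ P j, x ∉ Eb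
  unique : ∀ j ∈ J, ∀ x ∈ P j, ∀ y ∈ P j, x ∈ Er → y ∈ Er → x = y
  linkage : ∃ p, IsLinkage H C (A ∪ B ∪ {x | ∃ j ∈ J, x ∈ P j}) (Ea ∪ Eb ∪ Er) p

section Mixed

variable {V : Type*} [DecidableEq V] {H : SimpleGraph V} {A B C : Set V} {P : V → List V}
  {J Ea Eb Er : Finset V}

theorem MixedSystem.card_union (h : MixedSystem H A B C P J Ea Eb Er) :
    (Ea ∪ Eb ∪ Er).card = 2 * Ea.card + Er.card := by
  have h1 : Disjoint Ea Eb := Finset.disjoint_left.2 h.disjAB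
  have h2 : Disjoint (Ea ∪ Eb) Er := by
    rw [Finset.disjoint_left]
    intro x hx
    rcases Finset.mem_union.1 hx with hx | hx
    · exact h.disjAR x hx
    · exact h.disjBR x hx
  rw [Finset.card_union_of_disjoint h2, Finset.card_union_of_disjoint h1, ← h.card_eq]
  omega

/-- Two links that end in the same crossing `P j` are continued along it, one into `A` and the
other one into `B`. -/
theorem MixedSystem.release {y z p q j : V} {l m n : List V} {r : V → List V}
    (h : MixedSystem H A B C P J Ea Eb Er) (hyE : y ∉ Ea ∪ Eb ∪ Er)
    (hr : IsLinkage H C (A ∪ B ∪ {x | ∃ j ∈ J, x ∈ P j}) (insert y (Ea ∪ Eb ∪ Er)) r)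
    (hj : j ∈ J) (hzE : z ∈ Er) (hz : z ∈ P j) (hP : P j = l ++ p :: (m ++ q :: n))
    (hp : p = y ∨ p = z) (hq : q = y ∨ q = z) :
    ∃ a b, MixedSystem H A B C P (J.erase j) (insert a Ea) (insert b Eb) (Er.erase z) ∧
      a ∉ Ea := by
  obtain ⟨hc, hn, hne, hA, hB⟩ := h.crossing j hj
  have hzR : ∀ x ∈ Er, x ∈ P j → x = z := fun x hx hxj => h.unique j hj x hxj z hz hx hzE
  obtain ⟨a, ha⟩ : ∃ a, (P j).head? = some a := ⟨_, List.head?_eq_some_head hne⟩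
  obtain ⟨b, hb⟩ : ∃ b, (P j).getLast? = some b := ⟨_, List.getLast?_eq_some_getLast hne⟩
  have haj : a ∈ P j := List.mem_of_head? ha
  have hbj : b ∈ P j := List.mem_of_getLast? hb
  have haA : a ∈ A := (hA a haj).2 ha
  have hbB : b ∈ B := (hB b hbj).2 hb
  have e1 : P j = (l ++ [p]) ++ (m ++ q :: n) := by simp [hP]
  have e2 : P j = (l ++ p :: m) ++ (q :: n) := by simp [hP]
  have hn1 := hn
  have hn2 := hn
  have hc1 := hc
  have hc2 := hc
  rw [e1] at hn1 hc1
  rw [e2] at hn2 hc2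
  have ha1 : (l ++ [p]).head? = some a := by
    rw [← ha, hP]; cases l <;> simp
  have hb1 : (q :: n).getLast? = some b := by
    rw [← hb, hP]; simp [List.getLast?_append, List.getLast?_cons]
  have hal : a ∈ l ++ [p] := List.mem_of_head? ha1
  have hbl : b ∈ q :: n := List.mem_of_getLast? hb1
  have hlq : (l ++ [p]).Disjoint (q :: n) := fun x hx hx' =>
    (List.nodup_append'.1 hn1).2.2 hx (List.mem_append_right _ hx')
  have hab : a ≠ b := fun h => hlq hal (h ▸ hbl)
  have hl_sub : ∀ x ∈ l ++ [p], x ∈ P j := fun x hx => by rw [e1]; exact List.mem_append_left _ hx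
  have hq_sub : ∀ x ∈ q :: n, x ∈ P j := fun x hx => by rw [e2]; exact List.mem_append_right _ hx
  have haEa := h.notMemA j hj a haj
  have haEb := h.notMemB j hj a haj
  have hbEa := h.notMemA j hj b hbj
  have hbEb := h.notMemB j hj b hbj
  have hEj : ∀ e ∈ Ea ∪ Eb ∪ Er.erase z, e ∉ P j := by
    intro e he hej
    rcases Finset.mem_union.1 he with he | he
    · rcases Finset.mem_union.1 he with he | he
      · exact h.notMemA j hj e hej he
      · exact h.notMemB j hj e hej he
    · exact (Finset.ne_of_mem_erase he) (hzR e (Finset.mem_of_mem_erase he) hej)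
  have hother : ∀ x ∈ P j, ¬ ∃ i ∈ J.erase j, x ∈ P i := by
    rintro x hx ⟨i, hi, hxi⟩
    exact h.disjoint i (Finset.mem_of_mem_erase hi) j hj (Finset.ne_of_mem_erase hi) hxi hx
  have hpq : ∀ x, x = y ∨ x = z → x ∈ ((insert y (Ea ∪ Eb ∪ Er) : Finset V) : Set V) := by
    rintro x (rfl | rfl) <;> simp [hzE]
  have hlinkA : IsLink H ((insert y (Ea ∪ Eb ∪ Er) : Finset V) : Set V)
      (A ∪ B ∪ {x | ∃ i ∈ J.erase j, x ∈ P i}) (l ++ [p]).reverse a := by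
    refine ⟨?_, List.nodup_reverse.2 (List.nodup_append'.1 hn1).1, ⟨p, hpq p hp, by simp⟩, ?_, ?_⟩
    · rw [List.isChain_reverse]
      exact hc1.left_of_append.imp fun _ _ h => h.symm
    · rw [List.getLast?_reverse, ha1]
    · intro x hx
      rw [List.mem_reverse] at hx
      have hxj := hl_sub x hx
      constructor
      · rintro ((hxA | hxB) | hxP)
        · have := (hA x hxj).1 hxA
          rw [ha] at this
          exact (Option.some.inj this).symm
        · have := (hB x hxj).1 hxB
          rw [hb] at this
          have := Option.some.inj this
          subst this
          exact absurd hbl (fun h => hlq hx h)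
        · exact absurd hxP (hother x hxj)
      · rintro rfl
        exact Or.inl (Or.inl haA)
  have hlinkB : IsLink H ((insert y (Ea ∪ Eb ∪ Er) : Finset V) : Set V)
      (A ∪ B ∪ {x | ∃ i ∈ J.erase j, x ∈ P i}) (q :: n) b := by
    refine ⟨hc2.right_of_append, (List.nodup_append'.1 hn2).2.1, ⟨q, hpq q hq, by simp⟩, hb1, ?_⟩
    intro x hx
    have hxj := hq_sub x hx
    constructor
    · rintro ((hxA | hxB) | hxP)
      · have := (hA x hxj).1 hxA
        rw [ha] at this
        have := Option.some.inj this
        subst this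
        exact absurd hx (fun h => hlq hal h)
      · have := (hB x hxj).1 hxB
        rw [hb] at this
        exact (Option.some.inj this).symm
      · exact absurd hxP (hother x hxj)
    · rintro rfl
      exact Or.inl (Or.inr hbB)
  refine ⟨a, b, ⟨?_, ?_, ?_, ?_, ?_, ?_, ?_, ?_, ?_, ?_, ?_, ?_⟩, haEa⟩
  · exact fun i hi => h.crossing i (Finset.mem_of_mem_erase hi)
  · exact fun i hi i' hi' => h.disjoint i (Finset.mem_of_mem_erase hi) i' (Finset.mem_of_mem_erase hi')
  · intro e he
    rcases Finset.mem_insert.1 he with rfl | he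
    · exact haA
    · exact h.subA e he
  · intro e he
    rcases Finset.mem_insert.1 he with rfl | he
    · exact hbB
    · exact h.subB e he
  · intro e he he'
    rcases Finset.mem_insert.1 he with rfl | he1 <;> rcases Finset.mem_insert.1 he' with h' | he2
    · exact hab h'
    · exact haEb he2
    · exact hbEa (h' ▸ he1)
    · exact h.disjAB e he1 he2
  · intro e he he'
    rcases Finset.mem_insert.1 he with rfl | he1
    · exact hEj e (Finset.mem_union_right _ he') haj
    · exact h.disjAR e he1 (Finset.mem_of_mem_erase he')
  · intro e he he'
    rcases Finset.mem_insert.1 he with rfl | he1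
    · exact hEj e (Finset.mem_union_right _ he') hbj
    · exact h.disjBR e he1 (Finset.mem_of_mem_erase he')
  · rw [Finset.card_insert_of_notMem haEa, Finset.card_insert_of_notMem hbEb, h.card_eq]
  · intro i hi x hx hx'
    rcases Finset.mem_insert.1 hx' with rfl | hx'
    · exact hother x haj ⟨i, hi, hx⟩
    · exact h.notMemA i (Finset.mem_of_mem_erase hi) x hx hx'
  · intro i hi x hx hx'
    rcases Finset.mem_insert.1 hx' with rfl | hx'
    · exact hother x hbj ⟨i, hi, hx⟩
    · exact h.notMemB i (Finset.mem_of_mem_erase hi) x hx hx'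
  · exact fun i hi x hx x' hx' h1 h2 => h.unique i (Finset.mem_of_mem_erase hi) x hx x' hx'
      (Finset.mem_of_mem_erase h1) (Finset.mem_of_mem_erase h2)
  · have hmemB : ∀ x ∈ P j, x ∈ A ∪ B ∪ {x | ∃ j ∈ J, x ∈ P j} := fun x hx => Or.inr ⟨j, hj, hx⟩
    have hsub : (A ∪ B ∪ {x | ∃ i ∈ J.erase j, x ∈ P i}) ⊆ A ∪ B ∪ {x | ∃ j ∈ J, x ∈ P j} := by
      rintro x (hx | ⟨i, hi, hx⟩)
      · exact Or.inl hx
      · exact Or.inr ⟨i, Finset.mem_of_mem_erase hi, hx⟩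
    have hrest : ∀ e ∈ insert a Ea ∪ insert b Eb ∪ Er.erase z, e ≠ a → e ≠ b →
        e ∈ Ea ∪ Eb ∪ Er.erase z := by
      intro e he h1 h2
      simp only [Finset.mem_union, Finset.mem_insert] at he ⊢
      tauto
    have hrest' : ∀ e ∈ Ea ∪ Eb ∪ Er.erase z, e ∈ Ea ∪ Eb ∪ Er := by
      intro e he
      simp only [Finset.mem_union, Finset.mem_erase] at he ⊢
      tauto
    -- The two ends on the crossing run apart: from `p` backwards to its first vertex `a`, from `q`
    -- forwards to its last vertex `b`. All other ends stay put.
    refine hr.comp (q := fun e => if e = a then (l ++ [p]).reverse else if e = b then q :: n else [e])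
      hsub ⟨?_, ?_⟩ ?_
    · intro e he
      by_cases h1 : e = a
      · subst h1
        simpa only [if_true] using hlinkA
      by_cases h2 : e = b
      · subst h2
        simpa only [h1, if_true, if_false] using hlinkB
      simp only [h1, h2, if_false]
      have he' := hrest e he h1 h2
      refine IsLink.singleton (by simpa using Or.inr (by simpa using hrest' e he')) ?_
      have heB := (hr.1 e (Finset.mem_insert_of_mem (hrest' e he'))).last_mem
      rcases heB with heB | ⟨i, hi, hei⟩
      · exact Or.inl heB
      · refine Or.inr ⟨i, Finset.mem_erase.2 ⟨?_, hi⟩, hei⟩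
        rintro rfl
        exact hEj e he' hei
    · intro e he f hf hef
      have key : ∀ e ∈ insert a Ea ∪ insert b Eb ∪ Er.erase z, e ≠ a → e ≠ b → e ∉ P j :=
        fun e he h1 h2 => hEj e (hrest e he h1 h2)
      have hrev : ∀ x ∈ (l ++ [p]).reverse, x ∈ P j := fun x hx => hl_sub x (List.mem_reverse.1 hx)
      intro x hx hx'
      simp only at hx hx'
      split_ifs at hx hx' with h1 h2 h3 h4 h5 h6 h7 h8
      · exact hef (h1.trans h2.symm)
      · exact hlq (List.mem_reverse.1 hx) hx'
      · exact key f hf h2 h3 ((List.mem_singleton.1 hx') ▸ hrev x hx)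
      · exact hlq (List.mem_reverse.1 hx') hx
      · exact hef (h4.trans h6.symm)
      · exact key f hf h5 h6 ((List.mem_singleton.1 hx') ▸ hq_sub x hx)
      · exact key e he h1 h4 ((List.mem_singleton.1 hx) ▸ hrev x hx')
      · exact key e he h1 h4 ((List.mem_singleton.1 hx) ▸ hq_sub x hx')
      · exact hef ((List.mem_singleton.1 hx).symm.trans (List.mem_singleton.1 hx'))
    · intro e he x hx
      split_ifs at hx with h1 h2
      · exact hmemB x (hl_sub x (List.mem_reverse.1 hx))
      · exact hmemB x (hq_sub x hx)
      · rw [List.mem_singleton] at hx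
        subst hx
        exact (hr.1 x (Finset.mem_insert_of_mem (hrest' x (hrest x he h1 h2)))).last_mem

/-- One augmentation adds one link. A crossing is traded for a pair of ends in `Ea` and `Eb`, so the
number of crossings plus `Ea.card` is invariant. -/
theorem MixedSystem.step {k : ℕ} (h : MixedSystem H A B C P J Ea Eb Er)
    (hsep : ∀ Z : Finset V, Z.card < k → Unseparated H C (A ∪ B) Z)
    (hk : 2 * Ea.card + Er.card < k) :
    ∃ J' Ea' Eb' Er', MixedSystem H A B C P J' Ea' Eb' Er' ∧
      J'.card + Ea'.card = J.card + Ea.card ∧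
      2 * Ea'.card + Er'.card = 2 * Ea.card + Er.card + 1 := by
  obtain ⟨p, hp⟩ := h.linkage
  obtain ⟨y, hyE, r, hr⟩ := hp.augment _ _ _ p le_rfl fun Z hZ => by
    obtain ⟨x, hx, w, hw, hh⟩ := hsep Z (by rw [h.card_union] at hZ; omega)
    exact ⟨x, hx, w, Or.inl hw, hh⟩
  have hins : (insert y (Ea ∪ Eb ∪ Er) : Finset V) = Ea ∪ Eb ∪ insert y Er := by
    rw [Finset.union_insert]
  have hyE' := hyE
  simp only [Finset.mem_union, not_or] at hyE'
  obtain ⟨⟨hya, hyb⟩, hyr⟩ := hyE'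
  -- Only a second `Er`-end on one crossing violates `unique`; then the crossing is dissolved.
  -- Otherwise `y` simply joins `Er`.
  by_cases hmeet : ∃ j ∈ J, y ∈ P j ∧ ∃ z ∈ Er, z ∈ P j
  · obtain ⟨j, hj, hyj, z, hz, hzj⟩ := hmeet
    have hzy : z ≠ y := fun h => hyr (h ▸ hz)
    have hsplit : ∃ l p m q n, P j = l ++ p :: (m ++ q :: n) ∧ (p = y ∨ p = z) ∧
        (q = y ∨ q = z) := by
      obtain ⟨l, t, ht⟩ := List.append_of_mem hyj
      rw [ht] at hzj
      rcases List.mem_append.1 hzj with hzl | hzt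
      · obtain ⟨l₁, l₂, rfl⟩ := List.append_of_mem hzl
        exact ⟨l₁, z, l₂, y, t, by simp [ht], Or.inr rfl, Or.inl rfl⟩
      · obtain ⟨t₁, t₂, rfl⟩ := List.append_of_mem ((List.mem_cons.1 hzt).resolve_left hzy)
        exact ⟨l, y, t₁, z, t₂, ht, Or.inl rfl, Or.inr rfl⟩
    obtain ⟨l, p, m, q, n, hP, hp, hq⟩ := hsplit
    have hr' : IsLinkage H C (A ∪ B ∪ {x | ∃ j ∈ J, x ∈ P j}) (insert y (Ea ∪ Eb ∪ Er)) r := by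
      convert hr
    obtain ⟨a, b, hS, ha⟩ := h.release hyE hr' hj hz hzj hP hp hq
    refine ⟨_, _, _, _, hS, ?_, ?_⟩
    · rw [Finset.card_erase_of_mem hj, Finset.card_insert_of_notMem ha]
      have := Finset.card_pos.2 ⟨j, hj⟩
      omega
    · rw [Finset.card_erase_of_mem hz, Finset.card_insert_of_notMem ha]
      have := Finset.card_pos.2 ⟨z, hz⟩
      omega
  · refine ⟨J, Ea, Eb, insert y Er, ⟨h.crossing, h.disjoint, h.subA, h.subB, h.disjAB, ?_, ?_,
      h.card_eq, h.notMemA, h.notMemB, ?_, r, ?_⟩, rfl, ?_⟩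
    · intro e he he'
      rcases Finset.mem_insert.1 he' with rfl | he'
      · exact hya he
      · exact h.disjAR e he he'
    · intro e he he'
      rcases Finset.mem_insert.1 he' with rfl | he'
      · exact hyb he
      · exact h.disjBR e he he'
    · intro j hj x hx x' hx' h1 h2
      rcases Finset.mem_insert.1 h1 with h3 | h3 <;> rcases Finset.mem_insert.1 h2 with h4 | h4
      · exact h3.trans h4.symm
      · exact absurd ⟨j, hj, h3 ▸ hx, x', h4, hx'⟩ hmeet
      · exact absurd ⟨j, hj, h4 ▸ hx', x, h3, hx⟩ hmeet
      · exact h.unique j hj x hx x' hx' h3 h4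
    · rw [← hins]
      convert hr
    · rw [Finset.card_insert_of_notMem hyr]
      omega

theorem MixedSystem.exists_full {k : ℕ}
    (hsep : ∀ Z : Finset V, Z.card < k → Unseparated H C (A ∪ B) Z) (n : ℕ) :
    ∀ {J Ea Eb Er : Finset V}, MixedSystem H A B C P J Ea Eb Er →
    2 * Ea.card + Er.card + n = k →
    ∃ J' Ea' Eb' Er', MixedSystem H A B C P J' Ea' Eb' Er' ∧
      J'.card + Ea'.card = J.card + Ea.card ∧ 2 * Ea'.card + Er'.card = k := by
  induction n with
  | zero => exact fun h hk => ⟨_, _, _, _, h, rfl, by omega⟩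
  | succ n ih =>
    intro J Ea Eb Er h hk
    obtain ⟨J', Ea', Eb', Er', h', h1, h2⟩ := h.step hsep (by omega)
    obtain ⟨J'', Ea'', Eb'', Er'', h'', h3, h4⟩ := ih h' (by omega)
    exact ⟨_, _, _, _, h'', by omega, h4⟩

end Mixed

/-! ### From walks between terminals to walks between their neighbourhoods -/

/-- The graph obtained from `K` by deleting all edges that meet `S`. -/
def outside {V : Type*} (K : SimpleGraph V) (S : Set V) : SimpleGraph V where
  Adj u v := K.Adj u v ∧ u ∉ S ∧ v ∉ S
  symm := ⟨fun _ _ h => ⟨h.1.symm, h.2.2, h.2.1⟩⟩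
  loopless := ⟨fun _ h => h.1.ne rfl⟩

theorem Unseparated.mono {V : Type*} {H : SimpleGraph V} {A B B' : Set V} {Z : Finset V}
    (h : Unseparated H A B Z) (hB : B ⊆ B') : Unseparated H A B' Z := by
  obtain ⟨x, hx, y, hy, hh⟩ := h
  exact ⟨x, hx, y, hB hy, hh⟩

/-- Before its first visit to `T` a walk leaves `s` for the last time. The stretch in between avoids
all terminals, and it is nonempty because terminals are pairwise nonadjacent; so it runs from a
neighbour of `s` to a neighbour of `T`. Terminals may be visited even if they lie in `Z`, since the
stretch does not use them. -/
theorem unseparated_outside {V : Type*} {K : SimpleGraph V} {s t : V} {T : Set V} {Z : Finset V}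
    (hs : s ∉ T) (ht : t ∈ T) (hS : ∀ u ∈ insert s T, ∀ v ∈ insert s T, ¬ K.Adj u v)
    (hst : Relation.ReflTransGen (fun u v => K.Adj u v ∧ (v ∉ Z ∨ v ∈ insert s T)) s t) :
    Unseparated (outside K (insert s T)) {x | K.Adj s x} {y | ∃ t ∈ T, K.Adj t y} Z := by
  set U := Unseparated (outside K (insert s T)) {x | K.Adj s x} {y | ∃ t ∈ T, K.Adj t y} Z
  suffices h : ∀ v, Relation.ReflTransGen (fun u v => K.Adj u v ∧ (v ∉ Z ∨ v ∈ insert s T)) v t →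
      v ∈ T ∨ (v ∉ insert s T ∧ ∃ y ∈ {y | ∃ t ∈ T, K.Adj t y}, Relation.ReflTransGen
        (fun u v => (outside K (insert s T)).Adj u v ∧ v ∉ Z) v y) ∨ U by
    rcases h s hst with h | ⟨h, -⟩ | h
    · exact absurd h hs
    · exact absurd (Set.mem_insert _ _) h
    · exact h
  intro v hv
  induction hv using Relation.ReflTransGen.head_induction_on with
  | refl => exact Or.inl ht
  | @head u v huv _ ih =>
    by_cases huT : u ∈ T
    · exact Or.inl huT
    by_cases hus : u = s
    · subst hus
      have hv : v ∉ insert u T := fun hv => hS u (Set.mem_insert _ _) v hv huv.1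
      rcases ih with h | ⟨-, y, hy, h⟩ | h
      · exact absurd (Set.mem_insert_of_mem _ h) hv
      · exact Or.inr (Or.inr ⟨v, huv.1, y, hy, huv.2.resolve_right hv, h⟩)
      · exact Or.inr (Or.inr h)
    · have hu : u ∉ insert s T := by simp [hus, huT]
      rcases ih with h | ⟨hv, y, hy, h⟩ | h
      · exact Or.inr (Or.inl ⟨hu, u, ⟨v, h, huv.1.symm⟩, Relation.ReflTransGen.refl⟩)
      · exact Or.inr (Or.inl ⟨hu, y, hy,
          Relation.ReflTransGen.head ⟨⟨huv.1, hu, hv⟩, huv.2.resolve_right hv⟩ h⟩)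
      · exact Or.inr (Or.inr h)

/-! ### Gluing connected vertex sets -/

section InduceConnected

variable {V : Type*} {K : SimpleGraph V}

theorem induce_insert_connected {D : Set V} {a x : V} (hD : (K.induce D).Connected) (hx : x ∈ D)
    (ha : K.Adj a x) : (K.induce (insert a D)).Connected := by
  have h1 : (K.induce ({a, x} : Set V)).Connected := SimpleGraph.induce_pair_connected_of_adj ha
  have h2 := SimpleGraph.induce_union_connected h1.preconnected hD.preconnected
    ⟨x, by simp, hx⟩
  have e : ({a, x} : Set V) ∪ D = insert a D := by
    ext y; simp only [Set.mem_union, Set.mem_insert_iff, Set.mem_singleton_iff]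
    constructor
    · rintro ((h | rfl) | h) <;> simp_all
    · rintro (h | h) <;> simp_all
  rwa [e] at h2

theorem induce_union_connected_of_mem {D D' : Set V} {x : V} (hD : (K.induce D).Connected)
    (hD' : (K.induce D').Connected) (hx : x ∈ D) (hx' : x ∈ D') :
    (K.induce (D ∪ D')).Connected :=
  SimpleGraph.induce_union_connected hD.preconnected hD'.preconnected ⟨x, hx, hx'⟩

theorem induce_chain_connected {l : List V} (hl : l.IsChain K.Adj) (hne : l ≠ []) :
    (K.induce {x | x ∈ l}).Connected := by
  induction l with
  | nil => exact absurd rfl hne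
  | cons a l ih =>
    cases l with
    | nil =>
      have e : {x | x ∈ [a]} = ({a} : Set V) := by ext; simp
      rw [e]
      refine (SimpleGraph.connected_iff _).2 ⟨fun x y => ?_, ⟨⟨a, rfl⟩⟩⟩
      rw [Subsingleton.elim x y]
    | cons b l =>
      obtain ⟨h1, h2⟩ := List.isChain_cons_cons.1 hl
      have e : {x | x ∈ a :: b :: l} = insert a {x | x ∈ b :: l} := by
        ext; simp
      rw [e]
      exact induce_insert_connected (ih h2 (by simp)) (by simp) h1

end InduceConnected

/-! ### Numbering links and crossings compatibly -/

theorem Finset.exists_enumeration {V : Type*} [Nonempty V] (T : Finset V) :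
    ∃ g : ℕ → V, (∀ i < T.card, g i ∈ T) ∧ ∀ i < T.card, ∀ j < T.card, g i = g j → i = j := by
  refine ⟨fun i => if h : i < T.card then (T.equivFin.symm ⟨i, h⟩ : T).1 else
    Classical.arbitrary V, ?_, ?_⟩
  · intro i hi
    simp [hi]
  · intro i hi j hj hij
    simp only [hi, hj, dif_pos] at hij
    have := T.equivFin.symm.injective (Subtype.ext hij)
    simpa using this

section Align

variable {V : Type*} [DecidableEq V] {H : SimpleGraph V} {A B C : Set V} {P : V → List V}
  {J Ea Eb Er : Finset V}

/-- The ends in `Er` can be matched into distinct crossings, each end in a crossing to that one. -/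
theorem MixedSystem.exists_matching (h : MixedSystem H A B C P J Ea Eb Er)
    (hc : Er.card ≤ J.card) : ∃ μ : V → V, (∀ e ∈ Er, μ e ∈ J) ∧
      (∀ e ∈ Er, ∀ f ∈ Er, μ e = μ f → e = f) ∧ ∀ e ∈ Er, ∀ j ∈ J, e ∈ P j → μ e = j := by
  classical
  have hf : ∀ e, ∃ j, (∃ i ∈ J, e ∈ P i) → j ∈ J ∧ e ∈ P j := by
    intro e
    by_cases he : ∃ i ∈ J, e ∈ P i
    · obtain ⟨i, hi⟩ := he
      exact ⟨i, fun _ => hi⟩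
    · exact ⟨e, fun h => absurd h he⟩
  choose f hf using hf
  set E1 := Er.filter (fun e => ∃ i ∈ J, e ∈ P i) with hE1
  set E0 := Er.filter (fun e => ¬ ∃ i ∈ J, e ∈ P i) with hE0
  have hE1' : ∀ e, e ∈ E1 ↔ e ∈ Er ∧ ∃ i ∈ J, e ∈ P i := fun e => Finset.mem_filter
  have hE0' : ∀ e, e ∈ E0 ↔ e ∈ Er ∧ ¬ ∃ i ∈ J, e ∈ P i := fun e => Finset.mem_filter
  have hinj : ∀ e ∈ E1, ∀ e' ∈ E1, f e = f e' → e = e' := by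
    intro e he e' he' hee
    obtain ⟨h1, h2⟩ := (hE1' e).1 he
    obtain ⟨h3, h4⟩ := (hE1' e').1 he'
    exact h.unique (f e) (hf e h2).1 e (hf e h2).2 e' (hee ▸ (hf e' h4).2) h1 h3
  have hJ1 : (E1.image f).card = E1.card := Finset.card_image_of_injOn hinj
  have hsub : E1.image f ⊆ J := by
    intro j hj
    obtain ⟨e, he, rfl⟩ := Finset.mem_image.1 hj
    exact (hf e ((hE1' e).1 he).2).1
  have hcard : E1.card + E0.card = Er.card := Finset.card_filter_add_card_filter_not _
  have hle : E0.card ≤ (J \ E1.image f).card := by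
    rw [Finset.card_sdiff_of_subset hsub, hJ1]
    omega
  -- Ends on a crossing are matched to it, injectively by `unique`; the remaining ends are sent to
  -- crossings still free, of which there are enough.
  obtain ⟨φ⟩ := Function.Embedding.nonempty_of_card_le
    (α := E0) (β := (J \ E1.image f : Finset V)) (by simpa using hle)
  refine ⟨fun e => if he : e ∈ E0 then (φ ⟨e, he⟩).1 else f e, ?_, ?_, ?_⟩
  · intro e he
    by_cases h0 : e ∈ E0
    · simp only [h0, dif_pos]
      exact (Finset.mem_sdiff.1 (φ ⟨e, h0⟩).2).1
    · simp only [h0, dif_neg, not_false_iff]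
      have h1 : e ∈ E1 := by
        rw [hE1']; rw [hE0'] at h0; tauto
      exact (hf e ((hE1' e).1 h1).2).1
  · have hE : ∀ e ∈ Er, e ∉ E0 → e ∈ E1 := by
      intro e he h0
      rw [hE1']; rw [hE0'] at h0; tauto
    intro e he e' he' hee
    by_cases h0 : e ∈ E0 <;> by_cases h1 : e' ∈ E0 <;> simp only [h0, h1, dif_pos, dif_neg,
      not_false_iff] at hee
    · simpa using φ.injective (Subtype.ext hee)
    · exact absurd (Finset.mem_image.2 ⟨e', hE e' he' h1, hee.symm⟩)
        (Finset.mem_sdiff.1 (φ ⟨e, h0⟩).2).2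
    · exact absurd (Finset.mem_image.2 ⟨e, hE e he h0, hee⟩)
        (Finset.mem_sdiff.1 (φ ⟨e', h1⟩).2).2
    · exact hinj e (hE e he h0) e' (hE e' he' h1) hee
  · intro e he j hj hej
    have h0 : e ∉ E0 := by
      rw [hE0']; push Not; exact fun _ => ⟨j, hj, hej⟩
    simp only [h0, dif_neg, not_false_iff]
    obtain ⟨h1, h2⟩ := hf e ⟨j, hj, hej⟩
    by_contra hne
    exact h.disjoint _ h1 j hj hne h2 hej

/-- Enumerations of the links and the crossings of a full system such that the links ending in
`Er` are attached to the crossings in order. -/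
theorem MixedSystem.exists_aligned [Nonempty V] {k s : ℕ} (h : MixedSystem H A B C P J Ea Eb Er)
    (hs : Ea.card = s) (hJ : J.card + s = k) (hk : 2 * s + Er.card = k) :
    ∃ g q : ℕ → V, (∀ u < k, g u ∈ Ea ∪ Eb ∪ Er) ∧ (∀ u < k, ∀ v < k, g u = g v → u = v) ∧
      (∀ u < s, g u ∈ A) ∧ (∀ u, s ≤ u → u < 2 * s → g u ∈ B) ∧
      (∀ u < k - s, q u ∈ J) ∧ (∀ u < k - s, ∀ v < k - s, q u = q v → u = v) ∧
      (∀ u < k, ∀ v < k - s, g u ∈ P (q v) → u = v + s ∧ s ≤ v) ∧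
      ∀ u < k, 2 * s ≤ u → ∀ j ∈ J, g u ∈ P j → j = q (u - s) := by
  obtain ⟨μ, hμJ, hμi, hμP⟩ := h.exists_matching (by omega)
  have hsb : Eb.card = s := h.card_eq ▸ hs
  obtain ⟨ga, ga1, ga2⟩ := Ea.exists_enumeration
  obtain ⟨gb, gb1, gb2⟩ := Eb.exists_enumeration
  obtain ⟨gr, gr1, gr2⟩ := Er.exists_enumeration
  obtain ⟨gj, gj1, gj2⟩ := (J \ Er.image μ).exists_enumeration
  have hjc : (J \ Er.image μ).card = s := by
    rw [Finset.card_sdiff_of_subset, Finset.card_image_of_injOn hμi]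
    · omega
    · intro j hj
      obtain ⟨e, he, rfl⟩ := Finset.mem_image.1 hj
      exact hμJ e he
  rw [hs] at ga1 ga2
  rw [hsb] at gb1 gb2
  rw [hjc] at gj1 gj2
  -- Order of the links: `s` with ends in `Ea`, then `s` in `Eb`, then those in `Er`.
  set g : ℕ → V := fun u => if u < s then ga u else if u < 2 * s then gb (u - s) else
    gr (u - 2 * s) with hg
  -- The first `s` crossings are the unmatched ones; crossing `v ≥ s` is matched to link `v + s`.
  set q : ℕ → V := fun v => if v < s then gj v else μ (gr (v - s)) with hq
  have g1 : ∀ u, u < s → g u = ga u := fun u hu => by simp [hg, hu]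
  have g2 : ∀ u, s ≤ u → u < 2 * s → g u = gb (u - s) := fun u hu hu' => by
    simp [hg, hu', not_lt.2 hu]
  have g3 : ∀ u, 2 * s ≤ u → g u = gr (u - 2 * s) := fun u hu => by
    have : ¬ u < s := by omega
    simp [hg, this, not_lt.2 hu]
  have q1 : ∀ v, v < s → q v = gj v := fun v hv => by simp [hq, hv]
  have q2 : ∀ v, s ≤ v → q v = μ (gr (v - s)) := fun v hv => by simp [hq, not_lt.2 hv]
  have gcase : ∀ u < k, (u < s ∧ g u ∈ Ea) ∨ (s ≤ u ∧ u < 2 * s ∧ g u ∈ Eb) ∨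
      (2 * s ≤ u ∧ g u ∈ Er) := by
    intro u hu
    rcases lt_or_ge u s with h1 | h1
    · exact Or.inl ⟨h1, g1 u h1 ▸ ga1 u h1⟩
    rcases lt_or_ge u (2 * s) with h2 | h2
    · exact Or.inr (Or.inl ⟨h1, h2, g2 u h1 h2 ▸ gb1 _ (by omega)⟩)
    · exact Or.inr (Or.inr ⟨h2, g3 u h2 ▸ gr1 _ (by omega)⟩)
  have hqJ : ∀ u < k - s, q u ∈ J := by
    intro u hu
    rcases lt_or_ge u s with h1 | h1
    · rw [q1 u h1]
      exact (Finset.mem_sdiff.1 (gj1 u h1)).1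
    · rw [q2 u h1]
      exact hμJ _ (gr1 _ (by omega))
  have hqi : ∀ u < k - s, ∀ v < k - s, q u = q v → u = v := by
    have mixed : ∀ u < s, ∀ v < k - s, s ≤ v → q u ≠ q v := by
      intro u hu v hv hv' huv
      rw [q1 u hu, q2 v hv'] at huv
      exact (Finset.mem_sdiff.1 (gj1 u hu)).2
        (Finset.mem_image.2 ⟨_, gr1 _ (by omega), huv.symm⟩)
    intro u hu v hv huv
    rcases lt_or_ge u s with h1 | h1 <;> rcases lt_or_ge v s with h2 | h2
    · rw [q1 u h1, q1 v h2] at huv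
      exact gj2 u h1 v h2 huv
    · exact absurd huv (mixed u h1 v hv h2)
    · exact absurd huv.symm (mixed v h2 u hu h1)
    · rw [q2 u h1, q2 v h2] at huv
      have := gr2 _ (by omega) _ (by omega)
        (hμi _ (gr1 _ (by omega)) _ (gr1 _ (by omega)) huv)
      omega
  refine ⟨g, q, ?_, ?_, ?_, ?_, hqJ, hqi, ?_, ?_⟩
  · intro u hu
    rcases gcase u hu with h | h | h <;> simp [h]
  · intro u hu v hv huv
    rcases gcase u hu with h1 | h1 | h1 <;> rcases gcase v hv with h2 | h2 | h2
    · rw [g1 u h1.1, g1 v h2.1] at huv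
      exact ga2 u h1.1 v h2.1 huv
    · exact absurd (huv ▸ h2.2.2) (h.disjAB _ h1.2)
    · exact absurd (huv ▸ h2.2) (h.disjAR _ h1.2)
    · exact absurd (huv ▸ h1.2.2) (h.disjAB _ h2.2)
    · rw [g2 u h1.1 h1.2.1, g2 v h2.1 h2.2.1] at huv
      have := gb2 _ (by omega) _ (by omega) huv
      omega
    · exact absurd (huv ▸ h2.2) (h.disjBR _ h1.2.2)
    · exact absurd (huv ▸ h1.2) (h.disjAR _ h2.2)
    · exact absurd (huv ▸ h1.2) (h.disjBR _ h2.2.2)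
    · rw [g3 u h1.1, g3 v h2.1] at huv
      have := gr2 _ (by omega) _ (by omega) huv
      omega
  · intro u hu
    rw [g1 u hu]
    exact h.subA _ (ga1 u hu)
  · intro u hu hu'
    rw [g2 u hu hu']
    exact h.subB _ (gb1 _ (by omega))
  · intro u hu v hv huv
    rcases gcase u hu with h1 | h1 | h1
    · exact absurd h1.2 (h.notMemA _ (hqJ v hv) _ huv)
    · exact absurd h1.2.2 (h.notMemB _ (hqJ v hv) _ huv)
    · have h2 := hμP _ h1.2 _ (hqJ v hv) huv
      have h3 := q2 (u - s) (by omega)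
      rw [show u - s - s = u - 2 * s by omega, ← g3 u h1.1, h2] at h3
      replace h2 := h3
      have := hqi _ (by omega) _ hv h2
      omega
  · intro u hu hu' j hj huj
    rw [q2 (u - s) (by omega), show u - s - s = u - 2 * s by omega, ← g3 u hu']
    refine (hμP _ ?_ j hj huj).symm
    rw [g3 u hu']
    exact gr1 _ (by omega)

end Align

/-! ### Assembling connectors from a full mixed system -/

section Connectors

variable {V : Type*} {K : SimpleGraph V} {a b c : V}

theorem IsCrossing.connected {H : SimpleGraph V} {l : List V} (hH : H ≤ K)
    (h : IsCrossing H {x | K.Adj a x} {x | K.Adj b x} l) :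
    (K.induce ({a, b} ∪ {x | x ∈ l})).Connected := by
  obtain ⟨hc, -, hne, hA, hB⟩ := h
  have h1 := induce_chain_connected (hc.imp fun _ _ h => hH h) hne
  have hx := List.head?_eq_some_head hne
  have hy := List.getLast?_eq_some_getLast hne
  have h2 := induce_insert_connected h1 (List.mem_of_getLast? hy)
    ((hB _ (List.mem_of_getLast? hy)).2 hy)
  have h3 := induce_insert_connected h2 (Set.mem_insert_of_mem _ (List.mem_of_head? hx))
    ((hA _ (List.mem_of_head? hx)).2 hx)
  have e : ({a, b} ∪ {x | x ∈ l} : Set V) = insert a (insert b {x | x ∈ l}) := by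
    ext x; simp only [Set.mem_union, Set.mem_insert_iff, Set.mem_singleton_iff]; tauto
  rwa [e]

theorem IsLink.connected {H : SimpleGraph V} {B : Set V} {l : List V} {e : V} (hH : H ≤ K)
    (h : IsLink H {x | K.Adj c x} B l e) : (K.induce ({c} ∪ {x | x ∈ l})).Connected := by
  obtain ⟨x, hx, t, rfl⟩ := h.exists_cons
  exact induce_insert_connected (induce_chain_connected (h.1.imp fun _ _ h => hH h) (by simp))
    (by simp) hx

theorem MixedSystem.exists_connectors [DecidableEq V] {H : SimpleGraph V} (hH : H ≤ K)
    {P : V → List V} {J Ea Eb Er : Finset V} {k : ℕ}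
    (h : MixedSystem H {x | K.Adj a x} {x | K.Adj b x} {x | K.Adj c x} P J Ea Eb Er)
    (hJ : J.card + Ea.card = k) (hk : 2 * Ea.card + Er.card = k) :
    ∃ Q : ℕ → Set V, (∀ i < (3 * k + 1) / 4, (K.induce (Q i)).Connected ∧
        a ∈ Q i ∧ b ∈ Q i ∧ c ∈ Q i) ∧
      ∀ i < (3 * k + 1) / 4, ∀ j < (3 * k + 1) / 4, i ≠ j → ∀ x ∈ Q i, x ∈ Q j →
        x = a ∨ x = b ∨ x = c := by
  have : Nonempty V := ⟨a⟩
  obtain ⟨s, hs⟩ : ∃ s, Ea.card = s := ⟨_, rfl⟩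
  obtain ⟨g, q, hgE, hgi, hgA, hgB, hqJ, hqi, hgq, hgJ⟩ := h.exists_aligned hs (hs ▸ hJ) (hs ▸ hk)
  obtain ⟨p, hp⟩ := h.linkage
  obtain ⟨m, hm⟩ : ∃ m, m = s / 2 := ⟨_, rfl⟩
  rw [hs] at hJ hk
  have HL : ∀ x u v, u < k → v < k → x ∈ p (g u) → x ∈ p (g v) → u = v := by
    intro x u v hu hv hxu hxv
    by_contra hne
    exact hp.2 _ (hgE u hu) _ (hgE v hv) (fun h => hne (hgi u hu v hv h)) hxu hxv
  have HP : ∀ x u v, u < k - s → v < k - s → x ∈ P (q u) → x ∈ P (q v) → u = v := by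
    intro x u v hu hv hxu hxv
    by_contra hne
    exact h.disjoint _ (hqJ u hu) _ (hqJ v hv) (fun h => hne (hqi u hu v hv h)) hxu hxv
  have HX : ∀ x u v, u < k → v < k - s → x ∈ p (g u) → x ∈ P (q v) → u = v + s ∧ s ≤ v := by
    intro x u v hu hv hxu hxv
    have := ((hp.1 _ (hgE u hu)).2.2.2.2 x hxu).1 (Or.inr ⟨q v, hqJ v hv, hxv⟩)
    exact hgq u hu v hv (this ▸ hxv)
  -- Allocation of links (`L`) and crossings (`M`) to connector `i`. For `i < m`: a spare crossing
  -- and a link to `a`. For `m ≤ i < 2m`: a spare crossing and a link to `b`. For `2m ≤ i < s + m`: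
  -- a link to `a` and a link to `b`, no crossing. From `s + m` on: an `Er`-link with its matched
  -- crossing. For odd `s` one spare crossing is left over.
  set L : ℕ → ℕ → Prop := fun i u => (i < m ∧ u = i) ∨ (m ≤ i ∧ i < 2 * m ∧ u = s + i - m) ∨
    (2 * m ≤ i ∧ i < s + m ∧ (u = i - m ∨ u = s + i - m)) ∨ (s + m ≤ i ∧ u = s + i - m) with hL
  set M : ℕ → ℕ → Prop := fun i v => (i < 2 * m ∧ v = i) ∨ (s + m ≤ i ∧ v = i - m) with hM
  set T : ℕ → ℕ → Set V := fun u v => ({a, b} ∪ {x | x ∈ P (q v)}) ∪ ({c} ∪ {x | x ∈ p (g u)})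
    with hT
  have hline : ∀ u < k, (K.induce ({c} ∪ {x | x ∈ p (g u)})).Connected := fun u hu =>
    (hp.1 _ (hgE u hu)).connected hH
  have hpath : ∀ v < k - s, (K.induce ({a, b} ∪ {x | x ∈ P (q v)})).Connected := fun v hv =>
    (h.crossing _ (hqJ v hv)).connected hH
  have hlast : ∀ u < k, g u ∈ p (g u) := fun u hu => (hp.1 _ (hgE u hu)).mem_last
  have hTA : ∀ u < k, ∀ v < k - s, K.Adj a (g u) → (K.induce (T u v)).Connected := by
    intro u hu v hv ha
    have h1 := induce_insert_connected (hline u hu) (Set.mem_union_right _ (hlast u hu)) ha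
    have h2 := induce_union_connected_of_mem (x := a) (hpath v hv) h1 (by simp) (by simp)
    have e : T u v = {a, b} ∪ {x | x ∈ P (q v)} ∪ insert a ({c} ∪ {x | x ∈ p (g u)}) := by
      ext x; simp only [hT, Set.mem_union, Set.mem_insert_iff, Set.mem_singleton_iff]; tauto
    rwa [e]
  have hTB : ∀ u < k, ∀ v < k - s, K.Adj b (g u) → (K.induce (T u v)).Connected := by
    intro u hu v hv hb
    have h1 := induce_insert_connected (hline u hu) (Set.mem_union_right _ (hlast u hu)) hb
    have h2 := induce_union_connected_of_mem (x := b) (hpath v hv) h1 (by simp) (by simp)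
    have e : T u v = {a, b} ∪ {x | x ∈ P (q v)} ∪ insert b ({c} ∪ {x | x ∈ p (g u)}) := by
      ext x; simp only [hT, Set.mem_union, Set.mem_insert_iff, Set.mem_singleton_iff]; tauto
    rwa [e]
  -- An end adjacent to `a` or `b` attaches through that terminal whatever the crossing; an end on a
  -- crossing attaches there because the numbering matches it to that crossing.
  have hTP : ∀ u < k, 2 * s ≤ u → (K.induce (T u (u - s))).Connected := by
    intro u hu hu'
    rcases (hp.1 _ (hgE u hu)).last_mem with (hA | hB) | ⟨j, hj, hjP⟩
    · exact hTA u hu _ (by omega) hA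
    · exact hTB u hu _ (by omega) hB
    · have := hgJ u hu hu' j hj hjP
      subst this
      exact induce_union_connected_of_mem (x := g u) (hpath _ (by omega)) (hline u hu)
        (Set.mem_union_right _ hjP) (Set.mem_union_right _ (hlast u hu))
  set Q : ℕ → Set V := fun i => {x | x = a ∨ x = b ∨ x = c ∨ (∃ u, L i u ∧ x ∈ p (g u)) ∨
    ∃ v, M i v ∧ x ∈ P (q v)} with hQ
  have hQT : ∀ i u v, (∀ u', L i u' ↔ u' = u) → (∀ v', M i v' ↔ v' = v) → Q i = T u v := by
    intro i u v h1 h2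
    ext x
    simp only [hQ, hT, h1, h2, exists_eq_left, Set.mem_ofPred_eq, Set.mem_union, Set.mem_insert_iff,
      Set.mem_singleton_iff]
    tauto
  have hQL : ∀ i u v, (∀ u', L i u' ↔ u' = u ∨ u' = v) → (∀ v', ¬ M i v') →
      Q i = (insert a ({c} ∪ {x | x ∈ p (g u)})) ∪ (insert b ({c} ∪ {x | x ∈ p (g v)})) := by
    intro i u v h1 h2
    ext x
    simp only [hQ, h1, h2, Set.mem_ofPred_eq, Set.mem_union, Set.mem_insert_iff,
      Set.mem_singleton_iff, or_and_right, exists_or, exists_eq_left, false_and, exists_false]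
    tauto
  -- The indices stay in range because `2s ≤ k` gives `(3k + 1) / 4 ≤ k - s + m`.
  refine ⟨Q, fun i hi => ⟨?_, by simp [hQ], by simp [hQ], by simp [hQ]⟩, ?_⟩
  · by_cases h1 : i < m
    · rw [hQT i i i (fun u' => by simp only [hL]; omega) (fun v' => by simp only [hM]; omega)]
      exact hTA i (by omega) i (by omega) (hgA i (by omega))
    by_cases h2 : i < 2 * m
    · rw [hQT i (s + i - m) i (fun u' => by simp only [hL]; omega)
        (fun v' => by simp only [hM]; omega)]
      exact hTB _ (by omega) i (by omega) (hgB _ (by omega) (by omega))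
    by_cases h3 : i < s + m
    · rw [hQL i (i - m) (s + i - m) (fun u' => by simp only [hL]; omega)
        (fun v' => by simp only [hM]; omega)]
      refine induce_union_connected_of_mem (x := c)
        (induce_insert_connected (hline _ (by omega)) (Set.mem_union_right _ (hlast _ (by omega)))
          (hgA _ (by omega)))
        (induce_insert_connected (hline _ (by omega)) (Set.mem_union_right _ (hlast _ (by omega)))
          (hgB _ (by omega) (by omega))) (by simp) (by simp)
    · rw [hQT i (s + i - m) (i - m) (fun u' => by simp only [hL]; omega)
        (fun v' => by simp only [hM]; omega)]
      have := hTP (s + i - m) (by omega) (by omega)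
      rwa [show s + i - m - s = i - m by omega] at this
  · intro i hi j hj hij x hx hx'
    rcases hx with hx | hx | hx | hx
    · exact Or.inl hx
    · exact Or.inr (Or.inl hx)
    · exact Or.inr (Or.inr hx)
    rcases hx' with hx' | hx' | hx' | hx'
    · exact Or.inl hx'
    · exact Or.inr (Or.inl hx')
    · exact Or.inr (Or.inr hx')
    exfalso
    simp only [hL, hM] at hx hx'
    rcases hx with ⟨u, hu, hxu⟩ | ⟨u, hu, hxu⟩ <;> rcases hx' with ⟨v, hv, hxv⟩ | ⟨v, hv, hxv⟩
    · have := HL x u v (by omega) (by omega) hxu hxv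
      omega
    · have := HX x u v (by omega) (by omega) hxu hxv
      omega
    · have := HX x v u (by omega) (by omega) hxv hxu
      omega
    · have := HP x u v (by omega) (by omega) hxu hxv
      omega

end Connectors

theorem outside_le {V : Type*} (K : SimpleGraph V) (S : Set V) : outside K S ≤ K :=
  fun _ _ h => h.1

/-! ### Connectors for three pairwise nonadjacent terminals -/

section

variable {V : Type*} {K : SimpleGraph V} {a b c : V}

/-- A maximal system of paths between `a` and `b`, one of them possibly broken up at `c`. -/
theorem exists_mixedSystem [DecidableEq V] {k : ℕ} (hab : a ≠ b) (hk : 2 ≤ k) (habK : ¬ K.Adj a b)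
    (hacK : ¬ K.Adj a c) (hbcK : ¬ K.Adj b c)
    (hconn : ∀ Z : Finset V, Z.card < k → a ∉ Z → b ∉ Z →
      Relation.ReflTransGen (fun u v => K.Adj u v ∧ v ∉ Z) a b) :
    ∃ P J Ea Eb Er, MixedSystem (outside K (insert c {a, b})) {x | K.Adj a x} {x | K.Adj b x}
      {x | K.Adj c x} P J Ea Eb Er ∧ J.card + Ea.card = k ∧ 2 * Ea.card + Er.card ≤ k := by
  have hsep : ∀ Z : Finset V, Z.card < k →
      Unseparated (outside K (insert a {b})) {x | K.Adj a x} {x | K.Adj b x} Z := by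
    intro Z hZ
    -- The connectivity hypothesis concerns separators that miss the terminals, so these are erased
    -- from `Z` and readmitted as allowed vertices of the walk.
    have h := hconn ((Z.erase a).erase b)
      (lt_of_le_of_lt ((Finset.card_le_card (Finset.erase_subset _ _)).trans
        (Finset.card_le_card (Finset.erase_subset _ _))) hZ) (by simp) (by simp)
    refine (unseparated_outside (s := a) (t := b) (T := {b}) (by simpa using hab) rfl ?_
      (Relation.ReflTransGen.mono ?_ _ _ h)).mono ?_
    · rintro u (rfl | rfl) v (rfl | rfl)
      · exact K.irrefl
      · exact habK
      · exact fun h => habK h.symm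
      · exact K.irrefl
    · rintro u v ⟨h1, h2⟩
      refine ⟨h1, ?_⟩
      simp only [Finset.mem_erase, not_and, ne_eq] at h2
      simp only [Set.mem_insert_iff, Set.mem_singleton_iff]
      tauto
    · rintro y ⟨t, rfl, ht⟩
      exact ht
  obtain ⟨E, p, hE, hp⟩ := exists_linkage_of_unseparated k hsep
  have hcross : ∀ e, ∃ l, e ∈ E → IsCrossing (outside K (insert a {b})) {x | K.Adj a x}
      {x | K.Adj b x} l ∧ ∀ x ∈ l, x ∈ p e := by
    intro e
    by_cases he : e ∈ E
    · obtain ⟨l, hl⟩ := (hp.1 e he).exists_isCrossing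
      exact ⟨l, fun _ => hl⟩
    · exact ⟨[], fun h => absurd h he⟩
  choose P hP using hcross
  have hdis : ∀ i ∈ E, ∀ j ∈ E, i ≠ j → (P i).Disjoint (P j) := fun i hi j hj hij x hx hx' =>
    hp.2 i hi j hj hij ((hP i hi).2 x hx) ((hP j hj).2 x hx')
  have hchain : ∀ l : List V, l.IsChain (outside K (insert a {b})).Adj → c ∉ l →
      l.IsChain (outside K (insert c {a, b})).Adj := by
    intro l hl hcl
    refine hl.imp_of_mem_imp ?_
    rintro x y hx hy ⟨h1, h2, h3⟩
    refine ⟨h1, ?_, ?_⟩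
    · rintro (rfl | h)
      · exact hcl hx
      · exact h2 h
    · rintro (rfl | h)
      · exact hcl hy
      · exact h3 h
  by_cases hc : ∃ j ∈ E, c ∈ P j
  swap
  · refine ⟨P, E, ∅, ∅, ∅, ⟨?_, hdis, by simp, by simp, by simp, by simp, by simp, rfl, by simp,
      by simp, by simp, p, by simp, by simp⟩, by simpa using hE, by simp⟩
    intro j hj
    exact ⟨hchain _ (hP j hj).1.1 (fun h => hc ⟨j, hj, h⟩), (hP j hj).1.2⟩
  obtain ⟨j, hj, hcj⟩ := hc
  obtain ⟨hc, hn, hne, hA, hB⟩ := (hP j hj).1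
  obtain ⟨l, m, hlm⟩ := List.append_of_mem hcj
  rw [hlm] at hc hn
  have hl : l ≠ [] := by
    rintro rfl
    exact hacK ((hA c hcj).2 (by rw [hlm]; rfl))
  have hm : m ≠ [] := by
    rintro rfl
    exact hbcK ((hB c hcj).2 (by rw [hlm]; simp))
  obtain ⟨n1, n2, n3⟩ := List.nodup_append'.1 hn
  obtain ⟨n4, n5⟩ := List.nodup_cons.1 n2
  have hcl : c ∉ l := fun h => n3 h List.mem_cons_self
  obtain ⟨hc1, hc2, hc3⟩ := List.isChain_append.1 hc
  rw [List.isChain_cons] at hc2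
  set x := l.head hl with hx
  set y := m.getLast hm with hy
  have hPx : (P j).head? = some x := by
    rw [hlm, List.head?_append, List.head?_eq_some_head hl]; rfl
  have hPy : (P j).getLast? = some y := by
    rw [hlm, List.getLast?_append, List.getLast?_cons, List.getLast?_eq_some_getLast hm]; rfl
  have hxl : x ∈ l := List.head_mem hl
  have hym : y ∈ m := List.getLast_mem hm
  have hlP : ∀ z ∈ l, z ∈ P j := fun z hz => by rw [hlm]; simp [hz]
  have hmP : ∀ z ∈ m, z ∈ P j := fun z hz => by rw [hlm]; simp [hz]
  have hlm' : ∀ z ∈ l, z ∉ m := fun z hz hz' => n3 hz (List.mem_cons_of_mem _ hz')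
  have hxy : x ≠ y := fun h => hlm' x hxl (h ▸ hym)
  have hother : ∀ z ∈ P j, ∀ i ∈ E.erase j, z ∉ P i := fun z hz i hi hzi =>
    hdis i (Finset.mem_of_mem_erase hi) j hj (Finset.ne_of_mem_erase hi) hzi hz
  have hA' : ∀ z ∈ P j, K.Adj a z ↔ z = x := fun z hz => by
    rw [← Set.mem_ofPred_eq (p := fun z => K.Adj a z) (x := z), hA z hz, hPx]; simp [eq_comm]
  have hB' : ∀ z ∈ P j, K.Adj b z ↔ z = y := fun z hz => by
    rw [← Set.mem_ofPred_eq (p := fun z => K.Adj b z) (x := z), hB z hz, hPy]; simp [eq_comm]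
  set D : Set V := {x | K.Adj a x} ∪ {x | K.Adj b x} ∪ {x | ∃ i ∈ E.erase j, x ∈ P i} with hD
  have hDP : ∀ z ∈ P j, z ∈ D ↔ z = x ∨ z = y := by
    intro z hz
    simp only [hD, Set.mem_union, Set.mem_ofPred_eq, hA' z hz, hB' z hz]
    constructor
    · rintro (h | ⟨i, hi, h⟩)
      · exact h
      · exact absurd h (hother z hz i hi)
    · exact Or.inl
  -- The path through `c` is split there. Its halves, read away from `c`, are already a link ending
  -- at a neighbour `x` of `a` and a link ending at a neighbour `y` of `b`, as if the crossing had
  -- been released.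
  refine ⟨P, E.erase j, {x}, {y}, ∅, ⟨?_, ?_, ?_, ?_, ?_, by simp, by simp, rfl, ?_, ?_, by simp,
    fun e => if e = x then l.reverse else m, ?_, ?_⟩, ?_, ?_⟩
  · intro i hi
    have hi' := Finset.mem_of_mem_erase hi
    exact ⟨hchain _ (hP i hi').1.1 (hother c hcj i hi), (hP i hi').1.2⟩
  · exact fun i hi i' hi' => hdis i (Finset.mem_of_mem_erase hi) i' (Finset.mem_of_mem_erase hi')
  · intro e he
    rw [Finset.mem_singleton] at he
    exact he ▸ (hA' x (hlP x hxl)).2 rfl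
  · intro e he
    rw [Finset.mem_singleton] at he
    exact he ▸ (hB' y (hmP y hym)).2 rfl
  · simpa using hxy
  · intro i hi z hz hzx
    rw [Finset.mem_singleton] at hzx
    exact hother x (hlP x hxl) i hi (hzx ▸ hz)
  · intro i hi z hz hzx
    rw [Finset.mem_singleton] at hzx
    exact hother y (hmP y hym) i hi (hzx ▸ hz)
  · intro e he
    have he' : e = x ∨ e = y := by simpa using he
    rcases he' with rfl | rfl
    · simp only [if_true]
      refine ⟨?_, List.nodup_reverse.2 n1, ⟨l.getLast hl, ?_, ?_⟩, ?_, ?_⟩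
      · rw [List.isChain_reverse]
        exact (hchain l hc1 hcl).imp fun _ _ h => h.symm
      · exact (hc3 _ (List.getLast?_eq_some_getLast hl) c (by simp)).1.symm
      · rw [List.head?_reverse, List.getLast?_eq_some_getLast hl]
      · rw [List.getLast?_reverse, List.head?_eq_some_head hl]
      · intro z hz
        rw [List.mem_reverse] at hz
        rw [hDP z (hlP z hz)]
        refine ⟨fun h => h.resolve_right ?_, Or.inl⟩
        rintro rfl
        exact hlm' _ hz hym
    · simp only [hxy.symm, if_false]
      refine ⟨hchain m hc2.2 n4, n5, ⟨m.head hm, ?_, ?_⟩, ?_, ?_⟩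
      · exact (hc2.1 _ (List.head?_eq_some_head hm)).1
      · rw [List.head?_eq_some_head hm]
      · rw [List.getLast?_eq_some_getLast hm]
      · intro z hz
        rw [hDP z (hmP z hz)]
        refine ⟨fun h => h.resolve_left ?_, Or.inr⟩
        rintro rfl
        exact hlm' _ hxl hz
  · intro e he f hf hef z hz hz'
    have he' : e = x ∨ e = y := by simpa using he
    have hf' : f = x ∨ f = y := by simpa using hf
    rcases he' with h1 | h1 <;> rcases hf' with h2 | h2
    · exact hef (h1.trans h2.symm)
    · simp only [h1, h2, hxy.symm, if_true, if_false, List.mem_reverse] at hz hz'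
      exact hlm' z hz hz'
    · simp only [h1, h2, hxy.symm, if_true, if_false, List.mem_reverse] at hz hz'
      exact hlm' z hz' hz
    · exact hef (h1.trans h2.symm)
  · rw [Finset.card_erase_of_mem hj, Finset.card_singleton]
    omega
  -- The two halves count as two links, which is where `2 ≤ k` enters.
  · simp only [Finset.card_singleton, Finset.card_empty]
    omega

/-- If no fewer than `k` vertices separate `a` from `b`, or `c` from `a`, then there are
`⌊(3k+1)/4⌋` connected sets containing `a`, `b` and `c` that meet nowhere else. -/
theorem exists_connectors {k : ℕ} (hab : a ≠ b) (hac : a ≠ c) (hbc : b ≠ c) (hk : 2 ≤ k)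
    (habK : ¬ K.Adj a b) (hacK : ¬ K.Adj a c) (hbcK : ¬ K.Adj b c)
    (hconn : ∀ Z : Finset V, Z.card < k → a ∉ Z → b ∉ Z →
      Relation.ReflTransGen (fun u v => K.Adj u v ∧ v ∉ Z) a b)
    (hconn' : ∀ Z : Finset V, Z.card < k → c ∉ Z → a ∉ Z →
      Relation.ReflTransGen (fun u v => K.Adj u v ∧ v ∉ Z) c a) :
    ∃ Q : ℕ → Set V, (∀ i < (3 * k + 1) / 4, (K.induce (Q i)).Connected ∧
        a ∈ Q i ∧ b ∈ Q i ∧ c ∈ Q i) ∧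
      ∀ i < (3 * k + 1) / 4, ∀ j < (3 * k + 1) / 4, i ≠ j → ∀ x ∈ Q i, x ∈ Q j →
        x = a ∨ x = b ∨ x = c := by
  classical
  have hsep : ∀ Z : Finset V, Z.card < k → Unseparated (outside K (insert c {a, b}))
      {x | K.Adj c x} ({x | K.Adj a x} ∪ {x | K.Adj b x}) Z := by
    intro Z hZ
    have h := hconn' ((Z.erase c).erase a)
      (lt_of_le_of_lt ((Finset.card_le_card (Finset.erase_subset _ _)).trans
        (Finset.card_le_card (Finset.erase_subset _ _))) hZ) (by simp) (by simp)
    refine (unseparated_outside (s := c) (t := a) (T := {a, b}) (by simp [hac.symm, hbc.symm])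
      (by simp) ?_ (Relation.ReflTransGen.mono ?_ _ _ h)).mono ?_
    · have hba : ¬ K.Adj b a := fun h => habK h.symm
      have hca : ¬ K.Adj c a := fun h => hacK h.symm
      have hcb : ¬ K.Adj c b := fun h => hbcK h.symm
      rintro u (rfl | rfl | rfl) v (rfl | rfl | rfl) <;> first | exact K.irrefl | assumption
    · rintro u v ⟨h1, h2⟩
      refine ⟨h1, ?_⟩
      simp only [Finset.mem_erase, not_and, ne_eq] at h2
      simp only [Set.mem_insert_iff, Set.mem_singleton_iff]
      tauto
    · rintro y ⟨t, rfl | rfl, ht⟩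
      · exact Or.inl ht
      · exact Or.inr ht
  obtain ⟨P, J, Ea, Eb, Er, hS, h1, h2⟩ := exists_mixedSystem hab hk habK hacK hbcK hconn
  obtain ⟨J', Ea', Eb', Er', hS', h3, h4⟩ := hS.exists_full hsep _ (Nat.add_sub_cancel' h2)
  exact hS'.exists_connectors (outside_le K _) (by omega) h4

end

/-! ### Steiner trees from connected subgraphs -/

section Trees

variable {V : Type*} {G : SimpleGraph V}

theorem SimpleGraph.Subgraph.Connected.exists_isTree_le {T : G.Subgraph} (hT : T.Connected) :
    ∃ T' ≤ T, T'.verts = T.verts ∧ T'.coe.IsTree := by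
  obtain ⟨F, hF, hFt⟩ := SimpleGraph.Connected.exists_isTree_le hT.coe
  let T' : G.Subgraph :=
    { verts := T.verts
      Adj := fun u v => ∃ (hu : u ∈ T.verts) (hv : v ∈ T.verts), F.Adj ⟨u, hu⟩ ⟨v, hv⟩
      adj_sub := fun ⟨_, _, h⟩ => T.adj_sub (hF h)
      edge_vert := fun ⟨hu, _, _⟩ => hu
      symm := ⟨fun _ _ ⟨hu, hv, h⟩ => ⟨hv, hu, h.symm⟩⟩ }
  refine ⟨T', ⟨le_rfl, fun u v ⟨_, _, h⟩ => hF h⟩, rfl, ?_⟩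
  have e : T'.coe = F := by
    ext u v
    exact ⟨fun ⟨_, _, h⟩ => h, fun h => ⟨u.2, v.2, h⟩⟩
  rw [e]
  exact hFt

theorem bddAbove_localConn [Finite V] (S : Set V) :
    BddAbove {n : ℕ | ∃ F : Finset G.Subgraph, F.card = n ∧
      (∀ T ∈ F, GenConn.IsSteinerTree G S T) ∧
      ∀ T ∈ F, ∀ T' ∈ F, T ≠ T' → GenConn.InternallyDisjoint S T T'} := by
  have := Fintype.ofFinite G.Subgraph
  refine ⟨Fintype.card G.Subgraph, ?_⟩
  rintro n ⟨F, rfl, -⟩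
  exact Finset.card_le_univ F

/-- Connected subgraphs containing `S` that are disjoint outside `S` bound `κ(S)` from below. -/
theorem le_localConn [Finite V] {S : Set V} (hS : S.Nontrivial) {m : ℕ} (T : ℕ → G.Subgraph)
    (hT : ∀ i < m, (T i).Connected) (hST : ∀ i < m, S ⊆ (T i).verts)
    (hdis : ∀ i < m, ∀ j < m, i ≠ j →
      Disjoint (T i).edgeSet (T j).edgeSet ∧ (T i).verts ∩ (T j).verts ⊆ S) :
    m ≤ GenConn.localConn G S := by
  classical
  have hex : ∀ i, ∃ T', i < m → T' ≤ T i ∧ T'.verts = (T i).verts ∧ T'.coe.IsTree := by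
    intro i
    by_cases hi : i < m
    · obtain ⟨T', h⟩ := (hT i hi).exists_isTree_le
      exact ⟨T', fun _ => h⟩
    · exact ⟨⊥, fun h => absurd h hi⟩
  choose T' hT' using hex
  -- Every tree has an edge, so edge-disjoint trees are distinct and the family really has `m`
  -- members.
  have hedge : ∀ i < m, (T' i).edgeSet.Nonempty := by
    intro i hi
    obtain ⟨x, hx, y, hy, hxy⟩ := hS
    have hc := (hT' i hi).2.2.connected.preconnected
    have hx' : x ∈ (T' i).verts := (hT' i hi).2.1 ▸ hST i hi hx
    have hy' : y ∈ (T' i).verts := (hT' i hi).2.1 ▸ hST i hi hy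
    have : Nontrivial (T' i).verts := ⟨⟨x, hx'⟩, ⟨y, hy'⟩, by simpa using hxy⟩
    obtain ⟨z, hz⟩ := hc.exists_adj_of_nontrivial ⟨x, hx'⟩
    exact ⟨s(x, z), hz⟩
  have hd : ∀ i < m, ∀ j < m, i ≠ j → GenConn.InternallyDisjoint S (T' i) (T' j) := by
    intro i hi j hj hij
    obtain ⟨h1, h2⟩ := hdis i hi j hj hij
    constructor
    · rw [← Set.disjoint_iff_inter_eq_empty]
      exact h1.mono (SimpleGraph.Subgraph.edgeSet_mono (hT' i hi).1)
        (SimpleGraph.Subgraph.edgeSet_mono (hT' j hj).1)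
    · rw [(hT' i hi).2.1, (hT' j hj).2.1]
      exact Set.Subset.antisymm h2 (Set.subset_inter (hST i hi) (hST j hj))
  have hinj : ∀ i < m, ∀ j < m, T' i = T' j → i = j := by
    intro i hi j hj hij
    by_contra hne
    have h1 := (hd i hi j hj hne).1
    rw [← hij, Set.inter_self] at h1
    exact (hedge i hi).ne_empty h1
  refine le_csSup (bddAbove_localConn S) ⟨(Finset.range m).image T', ?_, ?_, ?_⟩
  · rw [Finset.card_image_of_injOn, Finset.card_range]
    intro i hi j hj hij
    exact hinj i (by simpa using hi) j (by simpa using hj) hij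
  · intro t ht
    obtain ⟨i, hi, rfl⟩ := Finset.mem_image.1 ht
    rw [Finset.mem_range] at hi
    exact ⟨(hT' i hi).2.2, (hT' i hi).2.1 ▸ hST i hi⟩
  · intro t ht t' ht' hne
    obtain ⟨i, hi, rfl⟩ := Finset.mem_image.1 ht
    obtain ⟨j, hj, rfl⟩ := Finset.mem_image.1 ht'
    rw [Finset.mem_range] at hi hj
    exact hd i hi j hj fun h => hne (h ▸ rfl)

theorem le_genConn [Finite V] {m : ℕ} (hG : G.Connected) (hV : 3 ≤ Nat.card V)
    (h : ∀ S : Finset V, S.card = 3 → m ≤ GenConn.localConn G (S : Set V)) :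
    m ≤ GenConn.genConn 3 G := by
  classical
  have := Fintype.ofFinite V
  rw [GenConn.genConn, if_pos hG, if_neg (by omega)]
  obtain ⟨S, -, hS⟩ := Finset.exists_subset_card_eq (s := (Finset.univ : Finset V)) (n := 3)
    (by rwa [Finset.card_univ, ← Nat.card_eq_fintype_card])
  refine le_csInf ⟨_, S, hS, rfl⟩ ?_
  rintro n ⟨S, hS, rfl⟩
  exact h S hS

end Trees

/-! ### Barycentric subdivision and the lower bound for `κ₃` -/

section Subdivision

variable {V : Type*}

/-- The barycentric subdivision of `G`. -/
def subdivision (G : SimpleGraph V) : SimpleGraph (V ⊕ Sym2 V) where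
  Adj x y := ∃ v, ∃ e ∈ G.edgeSet, v ∈ e ∧
    (x = Sum.inl v ∧ y = Sum.inr e ∨ x = Sum.inr e ∧ y = Sum.inl v)
  symm := ⟨by
    rintro x y ⟨v, e, he, hv, h | h⟩
    · exact ⟨v, e, he, hv, Or.inr h.symm⟩
    · exact ⟨v, e, he, hv, Or.inl h.symm⟩⟩
  loopless := ⟨by rintro x ⟨v, e, -, -, ⟨rfl, h⟩ | ⟨rfl, h⟩⟩ <;> cases h⟩

variable {G : SimpleGraph V}

theorem subdivision_not_adj_inl (u v : V) : ¬ (subdivision G).Adj (Sum.inl u) (Sum.inl v) := by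
  rintro ⟨v, e, -, -, ⟨_, h⟩ | ⟨h, _⟩⟩ <;> cases h

/-- The subgraph of `G` that a set of vertices of the subdivision stands for. -/
def subdivisionSubgraph (G : SimpleGraph V) (Q : Set (V ⊕ Sym2 V)) : G.Subgraph where
  verts := {v | Sum.inl v ∈ Q}
  Adj u v := G.Adj u v ∧ Sum.inl u ∈ Q ∧ Sum.inl v ∈ Q ∧ Sum.inr s(u, v) ∈ Q
  adj_sub h := h.1
  edge_vert h := h.2.1
  symm := ⟨fun u v h => ⟨h.1.symm, h.2.2.1, h.2.1, by rw [Sym2.eq_swap]; exact h.2.2.2⟩⟩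

theorem subdivisionSubgraph_connected {Q : Set (V ⊕ Sym2 V)} {a : V} (ha : Sum.inl a ∈ Q)
    (hQ : ((subdivision G).induce Q).Connected) : (subdivisionSubgraph G Q).Connected := by
  have ha' : a ∈ (subdivisionSubgraph G Q).verts := ha
  -- For the induction, reaching an edge-vertex is read as reaching all of its ends that lie in `Q`;
  -- an edge-vertex with only one end in `Q` does no harm.
  have key : ∀ x : Q, Relation.ReflTransGen ((subdivision G).induce Q).Adj ⟨Sum.inl a, ha⟩ x →
      ∀ v (hv : v ∈ (subdivisionSubgraph G Q).verts),
      (x.1 = Sum.inl v ∨ ∃ e ∈ G.edgeSet, x.1 = Sum.inr e ∧ v ∈ e) →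
      (subdivisionSubgraph G Q).coe.Reachable ⟨a, ha'⟩ ⟨v, hv⟩ := by
    intro x hx
    induction hx with
    | refl =>
      rintro v hv (h | ⟨e, -, h, -⟩)
      · cases h
        exact SimpleGraph.Reachable.refl _
      · cases h
    | @tail x y _ hxy ih =>
      have hxy' : (subdivision G).Adj x.1 y.1 := hxy
      obtain ⟨u, e, he, hu, ⟨hx, hy⟩ | ⟨hx, hy⟩⟩ := hxy'
      · rintro v hv (h | ⟨e', -, h, hve⟩)
        · rw [hy] at h; cases h
        · rw [hy] at h; cases h
          have huQ : u ∈ (subdivisionSubgraph G Q).verts := by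
            change Sum.inl u ∈ Q
            rw [← hx]; exact x.2
          have h1 := ih u huQ (Or.inl hx)
          by_cases huv : u = v
          · subst huv
            exact h1
          · have h2 := (Sym2.mem_and_mem_iff huv).1 ⟨hu, hve⟩
            subst h2
            refine h1.trans (SimpleGraph.Adj.reachable ?_)
            refine ⟨he, huQ, hv, ?_⟩
            rw [← hy]; exact y.2
      · rintro v hv (h | ⟨e', -, h, hve⟩)
        · rw [hy] at h; cases h
          exact ih u hv (Or.inr ⟨e, he, hx, hu⟩)
        · rw [hy] at h; cases h
  rw [SimpleGraph.Subgraph.connected_iff']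
  refine (SimpleGraph.connected_iff_exists_forall_reachable _).2 ⟨⟨a, ha'⟩, fun ⟨v, hv⟩ => ?_⟩
  refine key ⟨Sum.inl v, hv⟩ ?_ v hv (Or.inl rfl)
  rw [← SimpleGraph.reachable_iff_reflTransGen]
  exact hQ.preconnected _ _

theorem reflTransGen_outside {X : Finset V} (hX : (G.induce ((X : Set V)ᶜ)).Preconnected)
    {Z : Finset (V ⊕ Sym2 V)} (h1 : ∀ v ∉ X, Sum.inl v ∉ Z)
    (h2 : ∀ u ∉ X, ∀ v ∉ X, G.Adj u v → Sum.inr s(u, v) ∉ Z) {x y : V} (hx : x ∉ X) (hy : y ∉ X) :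
    Relation.ReflTransGen (fun u v => (subdivision G).Adj u v ∧ v ∉ Z) (Sum.inl x) (Sum.inl y) := by
  have h := hX ⟨x, by simpa using hx⟩ ⟨y, by simpa using hy⟩
  rw [SimpleGraph.reachable_iff_reflTransGen] at h
  suffices key : ∀ w, Relation.ReflTransGen (G.induce ((X : Set V)ᶜ)).Adj ⟨x, by simpa using hx⟩ w →
      Relation.ReflTransGen (fun u v => (subdivision G).Adj u v ∧ v ∉ Z) (Sum.inl x)
        (Sum.inl w.1) from key _ h
  intro w hw
  induction hw with
  | refl => exact Relation.ReflTransGen.refl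
  | @tail u v _ huv ih =>
    have hadj : G.Adj u.1 v.1 := huv
    have hu : u.1 ∉ X := fun h => u.2 (Finset.mem_coe.2 h)
    have hv : v.1 ∉ X := fun h => v.2 (Finset.mem_coe.2 h)
    refine (ih.tail (b := Sum.inl u.1) (c := Sum.inr s(u.1, v.1)) ⟨?_, h2 _ hu _ hv hadj⟩).tail
      ⟨?_, h1 _ hv⟩
    · exact ⟨u.1, _, hadj, by simp, Or.inl ⟨rfl, rfl⟩⟩
    · exact ⟨v.1, _, hadj, by simp, Or.inr ⟨rfl, rfl⟩⟩

/-- Two vertices of a `k`-connected graph cannot be separated in its subdivision by fewer than `k`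
vertices. -/
theorem subdivision_unseparated {k : ℕ} (hk : ∀ X : Finset V, X.card < k →
      (G.induce ((X : Set V)ᶜ)).Preconnected ∧ ¬ ((X : Set V)ᶜ).Subsingleton)
    {x y : V} (hxy : x ≠ y) (Z : Finset (V ⊕ Sym2 V)) (hZ : Z.card < k)
    (hx : Sum.inl x ∉ Z) (hy : Sum.inl y ∉ Z) :
    Relation.ReflTransGen (fun u v => (subdivision G).Adj u v ∧ v ∉ Z) (Sum.inl x) (Sum.inl y) := by
  classical
  have hpick : ∀ e : Sym2 V, ∃ v, (∃ w ∈ e, w ≠ x ∧ w ≠ y) → v ∈ e ∧ v ≠ x ∧ v ≠ y := by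
    intro e
    by_cases h : ∃ w ∈ e, w ≠ x ∧ w ≠ y
    · obtain ⟨w, hw⟩ := h
      exact ⟨w, fun _ => hw⟩
    · exact ⟨x, fun h' => absurd h' h⟩
  choose f hf using hpick
  -- Each edge-vertex of `Z` is replaced by an end of the edge other than `x, y`. Only the edge `xy`
  -- has no such end.
  set X := (((Z.erase (Sum.inr s(x, y))).image (Sum.elim id f)).erase x).erase y with hX
  have hXcard : X.card ≤ (Z.erase (Sum.inr s(x, y))).card :=
    (Finset.card_le_card (Finset.erase_subset _ _)).trans
      ((Finset.card_le_card (Finset.erase_subset _ _)).trans Finset.card_image_le)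
  have hxX : x ∉ X := by simp [hX]
  have hyX : y ∉ X := by simp [hX]
  have hmem : ∀ z ∈ Z, z ≠ Sum.inr s(x, y) → Sum.elim id f z ≠ x → Sum.elim id f z ≠ y →
      Sum.elim id f z ∈ X := fun z hz h1 h2 h3 => Finset.mem_erase.2 ⟨h3, Finset.mem_erase.2
        ⟨h2, Finset.mem_image.2 ⟨z, Finset.mem_erase.2 ⟨h1, hz⟩, rfl⟩⟩⟩
  have hvert : ∀ v ∉ X, Sum.inl v ∉ Z := by
    intro v hv hvZ
    exact hv (hmem _ hvZ (by simp) (by rintro rfl; exact hx hvZ) (by rintro rfl; exact hy hvZ))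
  have hedge : ∀ u ∉ X, ∀ v ∉ X, G.Adj u v → s(u, v) ≠ s(x, y) → Sum.inr s(u, v) ∉ Z := by
    intro u hu v hv huv hne hZ
    have hex : ∃ w ∈ s(u, v), w ≠ x ∧ w ≠ y := by
      by_contra hcon
      push Not at hcon
      have h1 := hcon u (by simp)
      have h2 := hcon v (by simp)
      apply hne
      have h3 := huv.ne
      by_cases hux : u = x <;> by_cases hvx : v = x
      · exact absurd (hux.trans hvx.symm) h3
      · rw [hux, h2 hvx]
      · rw [hvx, h1 hux, Sym2.eq_swap]
      · exact absurd ((h1 hux).trans (h2 hvx).symm) h3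
    obtain ⟨h1, h2, h3⟩ := hf _ hex
    have h4 := hmem _ hZ (fun h => hne (Sum.inr.inj h)) h2 h3
    simp only [Sum.elim_inr] at h4
    rcases Sym2.mem_iff.1 h1 with h | h
    · exact hu (h ▸ h4)
    · exact hv (h ▸ h4)
  by_cases hxyZ : Sum.inr s(x, y) ∈ Z
  · rw [Finset.card_erase_of_mem hxyZ] at hXcard
    have hpos := Finset.card_pos.2 ⟨_, hxyZ⟩
    -- If the edge `xy` is deleted, `X` has at most `k - 2` vertices and there is room to delete `x`
    -- or `y` as well. The walk goes through a third vertex `z`: from `x` to `z` avoiding `y`, then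
    -- from `z` to `y` avoiding `x`, so it never uses the edge `xy`.
    have hcx : (insert x X).card < k := (Finset.card_insert_le _ _).trans_lt (by omega)
    have hcy : (insert y X).card < k := (Finset.card_insert_le _ _).trans_lt (by omega)
    obtain ⟨p1, p2⟩ := hk _ hcx
    obtain ⟨p3, -⟩ := hk _ hcy
    rw [Set.not_subsingleton_iff] at p2
    obtain ⟨z, hz, hzy⟩ := p2.exists_ne y
    have hz' : z ≠ x ∧ z ∉ X := by simpa using hz
    have h1 : Relation.ReflTransGen (fun u v => (subdivision G).Adj u v ∧ v ∉ Z)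
        (Sum.inl x) (Sum.inl z) := by
      refine reflTransGen_outside p3 (fun v hv => hvert v (fun h => hv (by simp [h]))) ?_
        (by simp [hxX, hxy]) (by simp [hzy, hz'.2])
      intro u hu v hv huv
      simp only [Finset.mem_insert, not_or] at hu hv
      refine hedge u hu.2 v hv.2 huv ?_
      intro h
      have : y ∈ s(u, v) := by rw [h]; simp
      rcases Sym2.mem_iff.1 this with h | h
      · exact hu.1 h.symm
      · exact hv.1 h.symm
    have h2 : Relation.ReflTransGen (fun u v => (subdivision G).Adj u v ∧ v ∉ Z)
        (Sum.inl z) (Sum.inl y) := by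
      refine reflTransGen_outside p1 (fun v hv => hvert v (fun h => hv (by simp [h]))) ?_
        (by simp [hz']) (by simp [hyX, hxy.symm])
      intro u hu v hv huv
      simp only [Finset.mem_insert, not_or] at hu hv
      refine hedge u hu.2 v hv.2 huv ?_
      intro h
      have : x ∈ s(u, v) := by rw [h]; simp
      rcases Sym2.mem_iff.1 this with h | h
      · exact hu.1 h.symm
      · exact hv.1 h.symm
    exact h1.trans h2
  · have hc : X.card < k := (hXcard.trans (Finset.card_le_card (Finset.erase_subset _ _))).trans_lt hZ
    refine reflTransGen_outside (hk X hc).1 hvert ?_ hxX hyX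
    intro u hu v hv huv h
    by_cases hne : s(u, v) = s(x, y)
    · exact hxyZ (hne ▸ h)
    · exact hedge u hu v hv huv hne h

theorem of_card_lt_vertexConn {X : Finset V} (hX : X.card < GenConn.vertexConn G) :
    (G.induce ((X : Set V)ᶜ)).Preconnected ∧ ¬ ((X : Set V)ᶜ).Subsingleton := by
  have h := Nat.notMem_of_lt_sInf hX
  by_contra hcon
  refine h ⟨X, rfl, ?_⟩
  tauto

/-- The lower bound `κ₃(G) ≥ 3k + ⌈r/2⌉` for graphs with `κ(G) = 4k + r`. -/
theorem vertexConn_le_genConn [Finite V] (hG : G.Connected) (hV : 3 ≤ Nat.card V) :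
    (3 * GenConn.vertexConn G + 1) / 4 ≤ GenConn.genConn 3 G := by
  classical
  refine le_genConn hG hV fun S hS => ?_
  obtain ⟨a, b, c, hab, hac, hbc, rfl⟩ := Finset.card_eq_three.1 hS
  have hnt : (({a, b, c} : Finset V) : Set V).Nontrivial := ⟨a, by simp, b, by simp, hab⟩
  rcases Nat.lt_or_ge (GenConn.vertexConn G) 2 with hk | hk
  -- For `k ≤ 1` at most one tree is required, and the whole graph supplies it.
  · have h1 : 1 ≤ GenConn.localConn G (({a, b, c} : Finset V) : Set V) := by
      refine le_localConn hnt (fun _ => ⊤) (fun i hi => ?_) (fun i hi => Set.subset_univ _) ?_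
      · exact SimpleGraph.Connected.toSubgraph le_rfl hG
      · intro i hi j hj hij
        omega
    omega
  · obtain ⟨Q, hQ, hQd⟩ := exists_connectors (K := subdivision G) (a := Sum.inl a) (b := Sum.inl b)
      (c := Sum.inl c) (k := GenConn.vertexConn G) (by simpa using hab) (by simpa using hac)
      (by simpa using hbc) hk (subdivision_not_adj_inl _ _) (subdivision_not_adj_inl _ _)
      (subdivision_not_adj_inl _ _)
      (fun Z hZ h1 h2 => subdivision_unseparated (fun X hX => of_card_lt_vertexConn hX) hab Z hZ h1 h2)
      (fun Z hZ h1 h2 => subdivision_unseparated (fun X hX => of_card_lt_vertexConn hX) hac.symm Z hZ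
        h1 h2)
    refine le_localConn hnt (fun i => subdivisionSubgraph G (Q i)) ?_ ?_ ?_
    · exact fun i hi => subdivisionSubgraph_connected (hQ i hi).2.1 (hQ i hi).1
    · intro i hi v hv
      have hv' : v = a ∨ v = b ∨ v = c := by simpa using hv
      rcases hv' with rfl | rfl | rfl
      · exact (hQ i hi).2.1
      · exact (hQ i hi).2.2.1
      · exact (hQ i hi).2.2.2
    · intro i hi j hj hij
      constructor
      · rw [Set.disjoint_left]
        intro e
        induction e using Sym2.ind with
        | _ u v =>
          intro h1 h2
          have := hQd i hi j hj hij (Sum.inr s(u, v)) h1.2.2.2 h2.2.2.2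
          simp at this
      · rintro v ⟨h1, h2⟩
        have := hQd i hi j hj hij (Sum.inl v) h1 h2
        simpa using this

end Subdivision

/-! ### Upper bounds by degrees and cuts; the coefficient dominates `κ` -/

section UpperBounds

variable {V : Type*} {G : SimpleGraph V}

theorem genConn_le [Finite V] {S : Finset V} (hS : S.card = 3) {n : ℕ}
    (h : ∀ F : Finset G.Subgraph, (∀ T ∈ F, GenConn.IsSteinerTree G (S : Set V) T) →
      (∀ T ∈ F, ∀ T' ∈ F, T ≠ T' → GenConn.InternallyDisjoint (S : Set V) T T') → F.card ≤ n) :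
    GenConn.genConn 3 G ≤ n := by
  classical
  have hV : ¬ Nat.card V < 3 := by
    have := Fintype.ofFinite V
    rw [Nat.card_eq_fintype_card, ← hS, not_lt]
    exact Finset.card_le_univ S
  rw [GenConn.genConn]
  split_ifs
  · refine le_trans (b := GenConn.localConn G (S : Set V)) (Nat.sInf_le ⟨S, hS, rfl⟩)
      (csSup_le' ?_)
    rintro m ⟨F, rfl, h1, h2⟩
    exact h F h1 h2
  · exact Nat.zero_le n

theorem exists_card_three_of_pair [Finite V] (hV : 3 ≤ Nat.card V) (x y : V) :
    ∃ S : Finset V, S.card = 3 ∧ x ∈ S ∧ y ∈ S := by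
  classical
  have := Fintype.ofFinite V
  obtain ⟨S, hS, -, hc⟩ := Finset.exists_subsuperset_card_eq (s := {x, y}) (t := Finset.univ)
    (n := 3) (Finset.subset_univ _) (Finset.card_le_two.trans (by norm_num))
    (by rwa [Finset.card_univ, ← Nat.card_eq_fintype_card])
  exact ⟨S, hc, hS (by simp), hS (by simp)⟩

/-- With `v` among the terminals, each tree uses an edge at `v`, and edge-disjointness makes these
edges distinct. -/
theorem genConn_le_degree [Finite V] (hV : 3 ≤ Nat.card V) (v : V) [Fintype (G.neighborSet v)] :
    GenConn.genConn 3 G ≤ G.degree v := by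
  classical
  obtain ⟨S, hS, hvS, -⟩ := exists_card_three_of_pair hV v v
  obtain ⟨w, hw, hwv⟩ := Finset.exists_mem_ne (by omega : 1 < S.card) v
  refine genConn_le hS fun F hF hd => ?_
  have hadj : ∀ T : G.Subgraph, ∃ u, T ∈ F → T.Adj v u := by
    intro T
    by_cases hT : T ∈ F
    · have hv' : v ∈ T.verts := (hF T hT).2 hvS
      have hw' : w ∈ T.verts := (hF T hT).2 hw
      have : Nontrivial T.verts := ⟨⟨v, hv'⟩, ⟨w, hw'⟩, by simpa using hwv.symm⟩
      obtain ⟨z, hz⟩ := (hF T hT).1.connected.preconnected.exists_adj_of_nontrivial ⟨v, hv'⟩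
      exact ⟨z, fun _ => hz⟩
    · exact ⟨v, fun h => absurd h hT⟩
  choose φ hφ using hadj
  rw [← SimpleGraph.card_neighborFinset_eq_degree]
  refine Finset.card_le_card_of_injOn φ (fun T hT => ?_) ?_
  · simpa using (hφ T hT).adj_sub
  · intro T hT T' hT' heq
    by_contra hne
    have h1 := (hd T hT T' hT' hne).1
    have h2 : s(v, φ T) ∈ T.edgeSet ∩ T'.edgeSet := ⟨hφ T hT, heq ▸ hφ T' hT'⟩
    rw [h1] at h2
    exact h2

/-- Take as terminals two separated vertices and a third one outside `X`: each tree meets `X`, and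
no two trees share a vertex of `X`. -/
theorem genConn_le_card_of_cut [Finite V] (hV : 3 ≤ Nat.card V) {X : Finset V}
    (hX : ¬ (G.induce ((X : Set V)ᶜ)).Preconnected) : GenConn.genConn 3 G ≤ X.card := by
  classical
  rw [SimpleGraph.Preconnected] at hX
  push Not at hX
  obtain ⟨⟨x, hx⟩, ⟨y, hy⟩, hxy⟩ := hX
  have hx' : x ∉ X := fun h => hx (Finset.mem_coe.2 h)
  have hy' : y ∉ X := fun h => hy (Finset.mem_coe.2 h)
  have hne : x ≠ y := by
    rintro rfl
    exact hxy (SimpleGraph.Reachable.refl _)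
  by_cases hz : ∃ z ∉ X, z ≠ x ∧ z ≠ y
  · obtain ⟨z, hz, hzx, hzy⟩ := hz
    refine genConn_le (S := {x, y, z}) (Finset.card_eq_three.2
      ⟨x, y, z, hne, hzx.symm, hzy.symm, rfl⟩) fun F hF hd => ?_
    have hmeet : ∀ T : G.Subgraph, ∃ u, T ∈ F → u ∈ T.verts ∧ u ∈ X := by
      intro T
      by_cases hT : T ∈ F
      · by_contra hcon
        push Not at hcon
        have hTX : ∀ u ∈ T.verts, u ∈ ((X : Set V)ᶜ) := fun u hu h => (hcon u).2 hu h
        let g : T.coe →g G.induce ((X : Set V)ᶜ) :=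
          ⟨fun u => ⟨u.1, hTX u.1 u.2⟩, fun h => T.adj_sub h⟩
        have hr := (hF T hT).1.connected.preconnected
          ⟨x, (hF T hT).2 (by simp)⟩ ⟨y, (hF T hT).2 (by simp)⟩
        exact hxy (hr.map g)
      · exact ⟨x, fun h => absurd h hT⟩
    choose φ hφ using hmeet
    refine Finset.card_le_card_of_injOn φ (fun T hT => (hφ T hT).2) ?_
    intro T hT T' hT' heq
    by_contra hne'
    have h1 := (hd T hT T' hT' hne').2
    have h2 : φ T ∈ T.verts ∩ T'.verts := ⟨(hφ T hT).1, heq ▸ (hφ T' hT').1⟩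
    rw [h1] at h2
    have h3 : φ T = x ∨ φ T = y ∨ φ T = z := by simpa using h2
    have h4 := (hφ T hT).2
    rcases h3 with h | h | h <;> rw [h] at h4
    · exact hx' h4
    · exact hy' h4
    · exact hz h4
  -- Without a third vertex outside `X`, all neighbours of `x` lie in `X`, and the degree bound
  -- suffices.
  · push Not at hz
    have := Fintype.ofFinite V
    refine (genConn_le_degree hV x).trans ?_
    rw [← SimpleGraph.card_neighborFinset_eq_degree]
    refine Finset.card_le_card fun w hw => ?_
    rw [SimpleGraph.mem_neighborFinset] at hw
    by_contra hwX
    have := hz w hwX hw.ne'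
    subst this
    exact hxy (SimpleGraph.Adj.reachable hw)

theorem exists_card_eq_vertexConn [Finite V] (G : SimpleGraph V) :
    ∃ X : Finset V, X.card = GenConn.vertexConn G ∧
      (¬ (G.induce ((X : Set V)ᶜ)).Preconnected ∨ ((X : Set V)ᶜ).Subsingleton) := by
  have := Fintype.ofFinite V
  exact Nat.sInf_mem (s := {n : ℕ | ∃ X : Finset V, X.card = n ∧
    (¬ (G.induce ((X : Set V)ᶜ)).Preconnected ∨ ((X : Set V)ᶜ).Subsingleton)})
    ⟨_, Finset.univ, rfl, Or.inr (by simp)⟩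

/-- The preimage of a cut under a map contracting or preserving edges is a cut. -/
theorem not_preconnected_preimage {U : Type*} {Γ : SimpleGraph U} {π : U → V}
    (hπ : Function.Surjective π) (hadj : ∀ u v, Γ.Adj u v → π u = π v ∨ G.Adj (π u) (π v))
    {X : Finset V} {Y : Finset U} (hY : ∀ u, u ∈ Y ↔ π u ∈ X)
    (hX : ¬ (G.induce ((X : Set V)ᶜ)).Preconnected) :
    ¬ (Γ.induce ((Y : Set U)ᶜ)).Preconnected := by
  intro hΓ
  refine hX ?_
  have hmem : ∀ u ∈ ((Y : Set U)ᶜ), π u ∈ ((X : Set V)ᶜ) := fun u hu h =>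
    hu (Finset.mem_coe.2 ((hY u).2 (Finset.mem_coe.1 h)))
  have hmem' : ∀ u, π u ∈ ((X : Set V)ᶜ) → u ∈ ((Y : Set U)ᶜ) := fun u hu h =>
    hu (Finset.mem_coe.2 ((hY u).1 (Finset.mem_coe.1 h)))
  have key : ∀ u v : ((Y : Set U)ᶜ : Set U), (Γ.induce ((Y : Set U)ᶜ)).Reachable u v →
      (G.induce ((X : Set V)ᶜ)).Reachable ⟨π u, hmem u u.2⟩ ⟨π v, hmem v v.2⟩ := by
    intro u v h
    rw [SimpleGraph.reachable_iff_reflTransGen] at h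
    induction h with
    | refl => exact SimpleGraph.Reachable.refl _
    | @tail v w _ hvw ih =>
      refine ih.trans ?_
      rcases hadj v w hvw with h | h
      · simp only [h]
        exact SimpleGraph.Reachable.refl _
      · exact SimpleGraph.Adj.reachable h
  rintro ⟨x, hx⟩ ⟨y, hy⟩
  obtain ⟨x, rfl⟩ := hπ x
  obtain ⟨y, rfl⟩ := hπ y
  exact key ⟨x, hmem' x hx⟩ ⟨y, hmem' y hy⟩ (hΓ _ _)

theorem vertexConn_lt_card [Finite V] [Nonempty V] (G : SimpleGraph V) :
    GenConn.vertexConn G + 1 ≤ Nat.card V := by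
  classical
  have := Fintype.ofFinite V
  obtain ⟨v⟩ := ‹Nonempty V›
  have h : GenConn.vertexConn G ≤ (Finset.univ.erase v).card :=
    Nat.sInf_le ⟨Finset.univ.erase v, rfl, Or.inr fun x hx y hy => by
      simp only [Finset.coe_erase, Finset.coe_univ, Set.mem_compl_iff, Set.mem_sdiff, Set.mem_univ,
        Set.mem_singleton_iff, true_and, not_not] at hx hy
      rw [hx, hy]⟩
  rw [Finset.card_erase_of_mem (Finset.mem_univ v), Finset.card_univ,
    ← Nat.card_eq_fintype_card] at h
  have : 0 < Nat.card V := Nat.card_pos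
  omega

theorem one_le_vertexConn [Finite V] (hG : G.Connected) (hV : 2 ≤ Nat.card V) :
    1 ≤ GenConn.vertexConn G := by
  obtain ⟨X, hX, h⟩ := exists_card_eq_vertexConn G
  by_contra hcon
  have h0 : X = ∅ := Finset.card_eq_zero.1 (by omega)
  subst h0
  have hc : (((∅ : Finset V) : Set V)ᶜ) = Set.univ := by simp
  rw [hc] at h
  rcases h with h | h
  · exact h ((SimpleGraph.induceUnivIso G).preconnected_iff.2 hG.preconnected)
  · have := Set.subsingleton_univ_iff.1 h
    have := Finite.card_le_one_iff_subsingleton.2 this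
    omega

theorem one_le_genConn [Finite V] (hG : G.Connected) : 1 ≤ GenConn.genConn 3 G := by
  rcases Nat.lt_or_ge (Nat.card V) 3 with h | h
  · rw [GenConn.genConn, if_pos hG, if_pos h]
  · have h1 := vertexConn_le_genConn hG h
    have h2 := one_le_vertexConn hG (by omega)
    omega

/-- Substituting `κ₃(G) ≥ 3q + ⌈r/2⌉` for `κ(G) = 4q + r`, the terms in `⌈r/2⌉` cancel and `4q + r`
remains. The bound by 1 serves the one-vertex graph, where `κ = 0`. -/
theorem le_coeff [Finite V] (hG : G.Connected) :
    (GenConn.vertexConn G : ℤ) ≤ GenConn.coeff G ∧ 1 ≤ GenConn.coeff G := by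
  have h1 := one_le_genConn hG
  have h2 : (3 * GenConn.vertexConn G + 1) / 4 ≤ GenConn.genConn 3 G := by
    rcases Nat.lt_or_ge (Nat.card V) 3 with h | h
    · have := hG.nonempty
      have := vertexConn_lt_card G
      omega
    · exact vertexConn_le_genConn hG h
  rw [GenConn.coeff, Int.le_floor, Int.le_floor]
  generalize GenConn.genConn 3 G = n at *
  generalize GenConn.vertexConn G = k at *
  obtain ⟨q, r, hr, rfl⟩ : ∃ q r, r < 4 ∧ k = 4 * q + r := ⟨k / 4, k % 4, by omega, by omega⟩
  have e : (4 * q + r) % 4 = r := by omega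
  rw [e]
  have h1' : (1 : ℚ) ≤ n := by exact_mod_cast h1
  have hq : (0 : ℚ) ≤ q := by positivity
  interval_cases r
  · have h3 : (3 * q : ℚ) ≤ n := by exact_mod_cast (by omega : 3 * q ≤ n)
    norm_num
    constructor <;> linarith
  · have h3 : (3 * q + 1 : ℚ) ≤ n := by exact_mod_cast (by omega : 3 * q + 1 ≤ n)
    have hc : ⌈((1 : ℕ) : ℚ) / 2⌉ = 1 := by norm_num [Int.ceil_eq_iff]
    rw [hc]
    push_cast
    constructor <;> linarith
  · have h3 : (3 * q + 1 : ℚ) ≤ n := by exact_mod_cast (by omega : 3 * q + 1 ≤ n)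
    have hc : ⌈((2 : ℕ) : ℚ) / 2⌉ = 1 := by norm_num
    rw [hc]
    push_cast
    constructor <;> linarith
  · have h3 : (3 * q + 2 : ℚ) ≤ n := by exact_mod_cast (by omega : 3 * q + 2 ≤ n)
    have hc : ⌈((3 : ℕ) : ℚ) / 2⌉ = 2 := by norm_num [Int.ceil_eq_iff]
    rw [hc]
    push_cast
    constructor <;> linarith

end UpperBounds

/-! ### Upper bounds for the Cartesian product -/

section BoxProd

variable {V W : Type*} [Fintype V] [Fintype W] {G : SimpleGraph V} {H : SimpleGraph W}

theorem genConn_boxProd_le_minDegree [DecidableRel G.Adj] [DecidableRel H.Adj] [Nonempty V]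
    [Nonempty W] (hVW : 3 ≤ Nat.card (V × W)) :
    GenConn.genConn 3 (G.boxProd H) ≤ G.minDegree + H.minDegree := by
  classical
  obtain ⟨v, hv⟩ := G.exists_minimal_degree_vertex
  obtain ⟨w, hw⟩ := H.exists_minimal_degree_vertex
  have h := genConn_le_degree (G := G.boxProd H) hVW (v, w)
  rwa [SimpleGraph.degree_boxProd, ← hv, ← hw] at h

theorem genConn_boxProd_le_card [Nonempty V] [Nonempty W] (hVW : 3 ≤ Nat.card (V × W)) :
    GenConn.genConn 3 (G.boxProd H) + 2 ≤ Fintype.card V + Fintype.card W := by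
  classical
  have h := genConn_boxProd_le_minDegree (G := G) (H := H) hVW
  obtain ⟨v⟩ := ‹Nonempty V›
  obtain ⟨w⟩ := ‹Nonempty W›
  have h1 := (G.minDegree_le_degree v).trans_lt (G.degree_lt_card_verts v)
  have h2 := (H.minDegree_le_degree w).trans_lt (H.degree_lt_card_verts w)
  omega

/-- For `n = v - 1` the difference of the two sides is `(v - 2)(w - 1)`. -/
theorem card_sub_one_mul_ge {v w n : ℕ} (hv : 2 ≤ v) (hw : 1 ≤ w) (hn : v ≤ n + 1) :
    v + w ≤ n * w + 2 := by
  obtain ⟨m, rfl⟩ : ∃ m, n = m + 1 := ⟨n - 1, by omega⟩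
  obtain ⟨u, rfl⟩ : ∃ u, w = u + 1 := ⟨w - 1, by omega⟩
  nlinarith [Nat.zero_le (m * u)]

theorem card_le_of_compl_subsingleton {X : Finset V} (h : ((X : Set V)ᶜ).Subsingleton) :
    Fintype.card V ≤ X.card + 1 := by
  classical
  have h1 : (Xᶜ).card ≤ 1 := Finset.card_le_one.2 fun a ha b hb =>
    h (by simpa using ha) (by simpa using hb)
  have h2 := Finset.card_add_card_compl X
  omega

theorem genConn_boxProd_le_left [Nonempty W] (hVW : 3 ≤ Nat.card (V × W))
    (hV : 2 ≤ Fintype.card V) :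
    GenConn.genConn 3 (G.boxProd H) ≤ GenConn.vertexConn G * Fintype.card W := by
  classical
  have : Nonempty V := Fintype.card_pos_iff.1 (by omega)
  obtain ⟨X, hX, h⟩ := exists_card_eq_vertexConn G
  rw [← hX]
  rcases h with h | h
  · have hcut := not_preconnected_preimage (Γ := G.boxProd H) (π := Prod.fst) (X := X)
      (Y := X ×ˢ Finset.univ) Prod.fst_surjective (fun u v huv => by
        rcases SimpleGraph.boxProd_adj.1 huv with h | h
        · exact Or.inr h.1
        · exact Or.inl h.2) (by simp) h
    refine (genConn_le_card_of_cut hVW hcut).trans ?_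
    rw [Finset.card_product, Finset.card_univ]
  -- Here `κ(G) ≥ |V(G)| - 1` and there may be no cut to lift; the degree bound `|V(G)| + |V(H)| -
  -- 2` is small enough.
  · have h1 := genConn_boxProd_le_card (G := G) (H := H) hVW
    have h2 := card_sub_one_mul_ge hV (Fintype.card_pos (α := W)) (card_le_of_compl_subsingleton h)
    omega

theorem genConn_boxProd_le_right [Nonempty V] (hVW : 3 ≤ Nat.card (V × W))
    (hW : 2 ≤ Fintype.card W) :
    GenConn.genConn 3 (G.boxProd H) ≤ GenConn.vertexConn H * Fintype.card V := by
  classical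
  have : Nonempty W := Fintype.card_pos_iff.1 (by omega)
  obtain ⟨X, hX, h⟩ := exists_card_eq_vertexConn H
  rw [← hX]
  rcases h with h | h
  · have hcut := not_preconnected_preimage (Γ := G.boxProd H) (π := Prod.snd) (X := X)
      (Y := Finset.univ ×ˢ X) Prod.snd_surjective (fun u v huv => by
        rcases SimpleGraph.boxProd_adj.1 huv with h | h
        · exact Or.inl h.2
        · exact Or.inr h.1) (by simp) h
    refine (genConn_le_card_of_cut hVW hcut).trans ?_
    rw [Finset.card_product, Finset.card_univ, mul_comm]
  · have h1 := genConn_boxProd_le_card (G := G) (H := H) hVW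
    have h2 := card_sub_one_mul_ge hW (Fintype.card_pos (α := V)) (card_le_of_compl_subsingleton h)
    omega

theorem genConn_boxProd_le_upperBound [DecidableRel G.Adj] [DecidableRel H.Adj]
    (hG : G.Connected) (hH : H.Connected) (hne : Nontrivial V ∨ Nontrivial W) :
    (GenConn.genConn 3 (G.boxProd H) : ℤ) ≤ GenConn.upperBound G H := by
  have := hG.nonempty
  have := hH.nonempty
  obtain ⟨hG1, hG2⟩ := le_coeff hG
  obtain ⟨hH1, hH2⟩ := le_coeff hH
  have hcV : 1 ≤ Fintype.card V := Fintype.card_pos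
  have hcW : 1 ≤ Fintype.card W := Fintype.card_pos
  have hcard : Nat.card (V × W) = Fintype.card V * Fintype.card W := by
    rw [Nat.card_eq_fintype_card, Fintype.card_prod]
  have hcG : (Fintype.card W : ℤ) ≤ GenConn.coeff G * Fintype.card W :=
    le_mul_of_one_le_left (by positivity) hG2
  have hcH : (Fintype.card V : ℤ) ≤ GenConn.coeff H * Fintype.card V :=
    le_mul_of_one_le_left (by positivity) hH2
  have hvG : (GenConn.vertexConn G * Fintype.card W : ℤ) ≤ GenConn.coeff G * Fintype.card W :=
    mul_le_mul_of_nonneg_right hG1 (by positivity)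
  have hvH : (GenConn.vertexConn H * Fintype.card V : ℤ) ≤ GenConn.coeff H * Fintype.card V :=
    mul_le_mul_of_nonneg_right hH1 (by positivity)
  rw [GenConn.upperBound]
  rcases Nat.lt_or_ge (Nat.card (V × W)) 3 with h | h
  -- With fewer than three vertices in the product `κ₃` is 1 by convention, and each of the three
  -- bounds is positive.
  · have hone : GenConn.genConn 3 (G.boxProd H) = 1 := by
      rw [GenConn.genConn, if_pos (hG.boxProd hH), if_pos h]
    rw [hone]
    refine le_min (by push_cast; omega) (le_min (by push_cast; omega) ?_)
    rcases hne with hne | hne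
    · have := hG.preconnected.minDegree_pos_of_nontrivial
      push_cast; omega
    · have := hH.preconnected.minDegree_pos_of_nontrivial
      push_cast; omega
  · refine le_min ?_ (le_min ?_ ?_)
    -- A one-vertex factor has `κ = 0`, so the cut bound is unavailable; the degree bound gives at
    -- most `|V(H)| - 1`.
    · rcases Nat.lt_or_ge (Fintype.card V) 2 with h2 | h2
      · have := genConn_boxProd_le_card (G := G) (H := H) h
        omega
      · refine le_trans ?_ hvG
        exact_mod_cast genConn_boxProd_le_left h h2
    · rcases Nat.lt_or_ge (Fintype.card W) 2 with h2 | h2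
      · have := genConn_boxProd_le_card (G := G) (H := H) h
        omega
      · refine le_trans ?_ hvH
        exact_mod_cast genConn_boxProd_le_right h h2
    · exact_mod_cast genConn_boxProd_le_minDegree h

end BoxProd

/-! ### Sharpness: two disjoint trees in a product of minimum degree 2 -/

section Sharpness

/-- The complete graph on `1, …, p - 1` together with a pendant vertex `0` attached to `1`. -/
def pendantComplete (p : ℕ) : SimpleGraph (Fin p) where
  Adj i j := i ≠ j ∧ (i.1 = 0 → j.1 = 1) ∧ (j.1 = 0 → i.1 = 1)
  symm := ⟨fun _ _ h => ⟨h.1.symm, h.2.2, h.2.1⟩⟩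
  loopless := ⟨fun _ h => h.1 rfl⟩

theorem pendantComplete_adj {p : ℕ} {i j : Fin p} :
    (pendantComplete p).Adj i j ↔ i.1 ≠ j.1 ∧ (i.1 = 0 → j.1 = 1) ∧ (j.1 = 0 → i.1 = 1) := by
  simp only [pendantComplete, ne_eq, Fin.ext_iff]

variable {N : ℕ}

theorem pendantComplete_connected : (pendantComplete (N + 6)).Connected := by
  refine (SimpleGraph.connected_iff_exists_forall_reachable _).2 ⟨⟨1, by omega⟩, fun i => ?_⟩
  by_cases hi : i.1 = 1
  · have : i = ⟨1, by omega⟩ := Fin.ext hi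
    rw [this]
  · exact (pendantComplete_adj.2 ⟨fun h => hi h.symm, by simp, fun _ => rfl⟩).reachable

theorem pendantComplete_minDegree [DecidableRel (pendantComplete (N + 6)).Adj] :
    (pendantComplete (N + 6)).minDegree = 1 := by
  have h1 := (pendantComplete_connected (N := N)).preconnected.minDegree_pos_of_nontrivial
  have h2 := (pendantComplete (N + 6)).minDegree_le_degree 0
  have h3 : (pendantComplete (N + 6)).degree 0 = 1 := by
    rw [SimpleGraph.degree_eq_one_iff_existsUnique_adj]
    refine ⟨⟨1, by omega⟩, pendantComplete_adj.2 ⟨by simp, by simp, by simp⟩, ?_⟩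
    intro j hj
    exact Fin.ext ((pendantComplete_adj.1 hj).2.1 rfl)
  omega

/-- A bipartition of the vertices of the product of two pendant complete graphs. -/
def colour (i j : ℕ) : ℕ :=
  if 2 ≤ i then i % 2 else if 1 ≤ j then j % 2 else if i = 1 then 0 else 1

/-- A map between the indices from `2` on that changes the parity and has no cycle of length `2`. -/
def shift (i : ℕ) : ℕ :=
  if i % 2 = 0 then (if i = 4 then 5 else 3) else if i = 3 then 4 else 2

/-- A neighbour of the other colour, given without cycles of length `2`. -/
def mate (i j : ℕ) : ℕ × ℕ :=
  if 2 ≤ i then (shift i, j) else if i = 1 then (if colour i j = 0 then 3 else 2, j)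
  else if 1 ≤ j then (0, shift j) else (1, 0)

/-- On `2, …, 5` the map is the cycle `2 → 3 → 4 → 5 → 2`, and every other index is sent into it.
This is why six indices are needed. -/
theorem shift_props (i : ℕ) : 2 ≤ shift i ∧ shift i < 6 ∧ shift i % 2 ≠ i % 2 ∧
    shift (shift i) ≠ i := by
  unfold shift
  split_ifs <;> omega

theorem mate_lt {i j n : ℕ} (hn : 6 ≤ n) (hj : j < n) :
    (mate i j).1 < n ∧ (mate i j).2 < n := by
  have h1 := shift_props i
  have h2 := shift_props j
  unfold mate
  split_ifs <;> constructor <;> simp only <;> omega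

/-- The vertex of the product given by `mate`. -/
def mateVertex (x : Fin (N + 6) × Fin (N + 6)) : Fin (N + 6) × Fin (N + 6) :=
  (⟨(mate x.1 x.2).1, (mate_lt (by omega) x.2.2).1⟩,
    ⟨(mate x.1 x.2).2, (mate_lt (by omega) x.2.2).2⟩)

/-- The colour of a vertex of the product. -/
def colourVertex (x : Fin (N + 6) × Fin (N + 6)) : ℕ := colour x.1 x.2

theorem colour_lt (i j : ℕ) : colour i j < 2 := by
  unfold colour
  split_ifs <;> omega

theorem colour_mate (i j : ℕ) : colour (mate i j).1 (mate i j).2 ≠ colour i j := by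
  have h1 := shift_props i
  have h2 := shift_props j
  by_cases a1 : 2 ≤ i
  · simp only [mate, colour, a1, h1.1, if_true]
    omega
  by_cases a2 : i = 1
  · subst a2
    have c2 : colour 2 j = 0 := by simp [colour]
    have c3 : colour 3 j = 1 := by simp [colour]
    by_cases a3 : colour 1 j = 0
    · simp [mate, a3, c3]
    · simpa [mate, a3, c2] using Ne.symm a3
  by_cases a3 : 1 ≤ j
  · have : 1 ≤ shift j := by omega
    simp only [mate, colour, a1, a2, a3, this, if_true, if_false]
    simpa using h2.2.2.1
  · simp [mate, colour, a1, a2, a3]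

theorem mate_mate (i j : ℕ) : mate (mate i j).1 (mate i j).2 ≠ (i, j) := by
  have h1 := shift_props i
  have h2 := shift_props j
  by_cases a1 : 2 ≤ i
  · simp only [mate, a1, h1.1, if_true]
    intro h
    exact h1.2.2.2 (Prod.ext_iff.1 h).1
  by_cases a2 : i = 1
  · subst a2
    intro h
    have h3 := (Prod.ext_iff.1 h).1
    by_cases a3 : colour 1 j = 0 <;> simp [mate, a3, shift] at h3
  by_cases a3 : 1 ≤ j
  · have : 1 ≤ shift j := by omega
    have h0 : i = 0 := by omega
    subst h0
    intro h
    have h3 := (Prod.ext_iff.1 h).2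
    simp [mate, a3, this] at h3
    exact h2.2.2.2 h3
  · intro h
    have h3 := (Prod.ext_iff.1 h).1
    simp only [mate, a1, a2, a3, if_false] at h3
    by_cases a4 : colour 1 0 = 0 <;> simp [a4] at h3 <;> omega

theorem mate_adj (i j : ℕ) :
    (i ≠ (mate i j).1 ∧ (i = 0 → (mate i j).1 = 1) ∧ ((mate i j).1 = 0 → i = 1)) ∧ j = (mate i j).2 ∨
    (j ≠ (mate i j).2 ∧ (j = 0 → (mate i j).2 = 1) ∧ ((mate i j).2 = 0 → j = 1)) ∧
      i = (mate i j).1 := by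
  have h1 := shift_props i
  have h2 := shift_props j
  unfold mate
  by_cases a1 : 2 ≤ i
  · simp only [a1, if_true]
    exact Or.inl ⟨⟨by omega, fun _ => by omega, fun _ => by omega⟩, trivial⟩
  by_cases a2 : i = 1
  · subst a2
    by_cases a3 : colour 1 j = 0 <;> simp [a3]
  by_cases a3 : 1 ≤ j
  · simp only [a1, a2, a3, if_true, if_false]
    exact Or.inr ⟨⟨by omega, fun _ => by omega, fun _ => by omega⟩, by omega⟩
  · simp only [a1, a2, a3, if_false]
    exact Or.inl ⟨⟨a2, fun _ => trivial, fun h => by omega⟩, by omega⟩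

/-- The product of two pendant complete graphs. -/
abbrev pendantProd (N : ℕ) : SimpleGraph (Fin (N + 6) × Fin (N + 6)) :=
  (pendantComplete (N + 6)).boxProd (pendantComplete (N + 6))

theorem pendantProd_adj {x y : Fin (N + 6) × Fin (N + 6)} : (pendantProd N).Adj x y ↔
    (x.1.1 ≠ y.1.1 ∧ (x.1.1 = 0 → y.1.1 = 1) ∧ (y.1.1 = 0 → x.1.1 = 1)) ∧ x.2.1 = y.2.1 ∨
    (x.2.1 ≠ y.2.1 ∧ (x.2.1 = 0 → y.2.1 = 1) ∧ (y.2.1 = 0 → x.2.1 = 1)) ∧ x.1.1 = y.1.1 := by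
  rw [SimpleGraph.boxProd_adj, pendantComplete_adj, pendantComplete_adj, Fin.ext_iff, Fin.ext_iff]

theorem adj_mateVertex (x : Fin (N + 6) × Fin (N + 6)) : (pendantProd N).Adj x (mateVertex x) :=
  pendantProd_adj.2 (mate_adj x.1 x.2)

theorem colourVertex_mateVertex (x : Fin (N + 6) × Fin (N + 6)) :
    colourVertex (mateVertex x) ≠ colourVertex x :=
  colour_mate _ _

theorem mateVertex_mateVertex (x : Fin (N + 6) × Fin (N + 6)) :
    mateVertex (mateVertex x) ≠ x := by
  intro h
  refine mate_mate x.1 x.2 ?_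
  have h1 := congrArg (fun y => (y.1.1, y.2.1)) h
  exact h1

/-- Colour classes extended by `S`, where a vertex of the other colour is attached to its mate. -/
def colourSubgraph (S : Set (Fin (N + 6) × Fin (N + 6))) (k : ℕ) : (pendantProd N).Subgraph where
  verts := {x | colourVertex x = k ∨ x ∈ S}
  Adj x y := (pendantProd N).Adj x y ∧ ((colourVertex x = k ∧ colourVertex y = k) ∨
    (x ∈ S ∧ colourVertex x ≠ k ∧ y = mateVertex x ∧ colourVertex y = k) ∨
    (y ∈ S ∧ colourVertex y ≠ k ∧ x = mateVertex y ∧ colourVertex x = k))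
  adj_sub h := h.1
  edge_vert := by
    rintro x y ⟨-, ⟨h, -⟩ | ⟨h, -⟩ | ⟨-, -, -, h⟩⟩
    · exact Or.inl h
    · exact Or.inr h
    · exact Or.inl h
  symm := ⟨by
    rintro x y ⟨h0, ⟨h, h'⟩ | h | h⟩
    · exact ⟨h0.symm, Or.inl ⟨h', h⟩⟩
    · exact ⟨h0.symm, Or.inr (Or.inr h)⟩
    · exact ⟨h0.symm, Or.inr (Or.inl h)⟩⟩

theorem colourSubgraph_connected (S : Set (Fin (N + 6) × Fin (N + 6))) {k : ℕ} (hk : k < 2) :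
    (colourSubgraph S k).Connected := by
  have hcol : ∀ i j : Fin (N + 6), colourVertex (i, j) = colour i j := fun _ _ => rfl
  -- All vertices with first coordinate `k + 2 ≥ 2` have colour `k`, and they form a connected copy
  -- of the second factor. It serves as a hub for the class.
  let b : Fin (N + 6) := ⟨k + 2, by omega⟩
  have hb : ∀ j : Fin (N + 6), colourVertex (b, j) = k := by
    intro j
    rw [hcol]
    simp only [b, colour]
    rw [if_pos (by omega)]
    omega
  have hv : ∀ {x}, colourVertex x = k → x ∈ (colourSubgraph S k).verts := fun h => Or.inl h
  have step : ∀ x y (hx : colourVertex x = k) (hy : colourVertex y = k), (pendantProd N).Adj x y →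
      (colourSubgraph S k).coe.Reachable ⟨x, hv hx⟩ ⟨y, hv hy⟩ := fun x y hx hy h =>
    SimpleGraph.Adj.reachable ⟨h, Or.inl ⟨hx, hy⟩⟩
  have row : ∀ j : Fin (N + 6), (colourSubgraph S k).coe.Reachable ⟨(b, j), hv (hb j)⟩
      ⟨(b, b), hv (hb b)⟩ := by
    have h1 : ∀ j : Fin (N + 6), j.1 ≠ 0 → (colourSubgraph S k).coe.Reachable ⟨(b, j), hv (hb j)⟩
        ⟨(b, b), hv (hb b)⟩ := by
      intro j hj
      by_cases hjb : j = b
      · rw [hjb]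
      · refine step _ _ (hb j) (hb b) (pendantProd_adj.2 (Or.inr ⟨⟨fun h => hjb (Fin.ext h), ?_, ?_⟩, rfl⟩))
        · exact fun h => absurd h hj
        · intro h
          simp [b] at h
    intro j
    by_cases hj : j.1 = 0
    · refine (step (b, j) (b, ⟨1, by omega⟩) (hb j) (hb _) (pendantProd_adj.2
        (Or.inr ⟨⟨?_, ?_, ?_⟩, rfl⟩))).trans (h1 _ (by simp)) <;> simp [hj]
    · exact h1 j hj
  have clique : ∀ i j : Fin (N + 6), i.1 ≠ 0 → (h : colourVertex (i, j) = k) →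
      (colourSubgraph S k).coe.Reachable ⟨(i, j), hv h⟩ ⟨(b, b), hv (hb b)⟩ := by
    intro i j hi h
    by_cases hib : i = b
    · subst hib
      exact row j
    · refine (step _ (b, j) h (hb j) (pendantProd_adj.2
        (Or.inl ⟨⟨fun h => hib (Fin.ext h), fun h => absurd h hi, ?_⟩, rfl⟩))).trans (row j)
      intro h
      simp [b] at h
  have class_reach : ∀ x, (h : colourVertex x = k) →
      (colourSubgraph S k).coe.Reachable ⟨x, hv h⟩ ⟨(b, b), hv (hb b)⟩ := by
    rintro ⟨i, j⟩ h
    by_cases hi : i.1 = 0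
    · have hi' : i = 0 := Fin.ext hi
      subst hi'
      by_cases hj : j.1 = 0
      · have hj' : j = 0 := Fin.ext hj
        subst hj'
        have hk1 : k = 1 := by
          rw [← h]; rfl
        have h01 : colourVertex (((0 : Fin (N + 6)), (⟨1, by omega⟩ : Fin (N + 6)))) = k := by
          rw [hk1]; rfl
        have h11 : colourVertex (((⟨1, by omega⟩ : Fin (N + 6)), (⟨1, by omega⟩ : Fin (N + 6)))) =
            k := by
          rw [hk1]; rfl
        refine (step _ _ h h01 (pendantProd_adj.2 (Or.inr (by simp)))).trans
          ((step _ _ h01 h11 (pendantProd_adj.2 (Or.inl (by simp)))).trans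
          (clique _ _ (by simp) h11))
      · have h1 : colourVertex (((⟨1, by omega⟩ : Fin (N + 6)), j)) = k := by
          rw [← h, hcol, hcol]
          have : 1 ≤ j.1 := by omega
          simp [colour, this]
        exact (step _ _ h h1 (pendantProd_adj.2 (Or.inl (by simp)))).trans
          (clique _ _ (by simp) h1)
    · exact clique i j hi h
  rw [SimpleGraph.Subgraph.connected_iff']
  refine (SimpleGraph.connected_iff_exists_forall_reachable _).2 ⟨⟨(b, b), hv (hb b)⟩, ?_⟩
  rintro ⟨x, hx⟩
  symm
  by_cases hxk : colourVertex x = k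
  · exact class_reach x hxk
  · have hxS : x ∈ S := hx.resolve_left hxk
    have hm : colourVertex (mateVertex x) = k := by
      have h1 := colourVertex_mateVertex x
      have h2 : colourVertex x < 2 := colour_lt _ _
      have h3 : colourVertex (mateVertex x) < 2 := colour_lt _ _
      omega
    refine SimpleGraph.Reachable.trans (SimpleGraph.Adj.reachable ?_) (class_reach _ hm)
    exact ⟨adj_mateVertex x, Or.inr (Or.inl ⟨hxS, hxk, rfl, hm⟩)⟩

theorem two_le_genConn_pendantProd (N : ℕ) : 2 ≤ GenConn.genConn 3 (pendantProd N) := by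
  have hcard : 3 ≤ Nat.card (Fin (N + 6) × Fin (N + 6)) := by
    rw [Nat.card_eq_fintype_card, Fintype.card_prod, Fintype.card_fin]
    nlinarith
  refine le_genConn (pendantComplete_connected.boxProd pendantComplete_connected) hcard
    fun S hS => ?_
  obtain ⟨x, hx, y, hy, hxy⟩ := Finset.one_lt_card.1 (by omega : 1 < S.card)
  refine le_localConn ⟨x, hx, y, hy, hxy⟩ (colourSubgraph (S : Set _))
    (fun i hi => colourSubgraph_connected _ hi) (fun i _ v hv => Or.inr hv) ?_
  intro i hi j hj hij
  constructor
  · rw [Set.disjoint_left]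
    intro e
    induction e using Sym2.ind with
    | _ u v =>
      rintro ⟨-, h1⟩ ⟨-, h2⟩
      -- A common edge would have to join two vertices that are mates of each other, since every
      -- other combination contradicts the colours.
      rcases h1 with ⟨a1, a2⟩ | ⟨a1, a2, a3, a4⟩ | ⟨a1, a2, a3, a4⟩ <;>
        rcases h2 with ⟨b1, b2⟩ | ⟨b1, b2, b3, b4⟩ | ⟨b1, b2, b3, b4⟩ <;>
        first
        | omega
        | (refine mateVertex_mateVertex u ?_; rw [← a3, ← b3])
        | (refine mateVertex_mateVertex u ?_; rw [← b3, ← a3])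
  · rintro v ⟨h1 | h1, h2 | h2⟩
    · exact absurd (h1.symm.trans h2) hij
    · exact h2
    · exact h1
    · exact h1

theorem genConn_pendantProd_eq_upperBound (N : ℕ) [DecidableRel (pendantComplete (N + 6)).Adj] :
    (GenConn.genConn 3 (pendantProd N) : ℤ) =
      GenConn.upperBound (pendantComplete (N + 6)) (pendantComplete (N + 6)) := by
  refine le_antisymm (genConn_boxProd_le_upperBound pendantComplete_connected
    pendantComplete_connected (Or.inl inferInstance)) ?_
  -- Only the degree term of the minimum is needed: the pendant vertices make it `1 + 1`.
  have h1 : GenConn.upperBound (pendantComplete (N + 6)) (pendantComplete (N + 6)) ≤ 2 := by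
    refine (min_le_right _ _).trans ((min_le_right _ _).trans ?_)
    rw [pendantComplete_minDegree]
    norm_num
  have h2 : (2 : ℤ) ≤ GenConn.genConn 3 (pendantProd N) := by
    exact_mod_cast two_le_genConn_pendantProd N
  exact h1.trans h2

end Sharpness

theorem theorem1p8 :
    (∀ {V : Type*} {W : Type*} [Fintype V] [Fintype W]
      (G : SimpleGraph V) (H : SimpleGraph W) [DecidableRel G.Adj] [DecidableRel H.Adj],
      G.Connected → H.Connected → (Nontrivial V ∨ Nontrivial W) →
        (GenConn.genConn 3 (SimpleGraph.boxProd G H) : ℤ) ≤ GenConn.upperBound G H) ∧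
    (∀ N : ℕ, ∃ (p q : ℕ) (G : SimpleGraph (Fin p)) (H : SimpleGraph (Fin q))
      (_ : DecidableRel G.Adj) (_ : DecidableRel H.Adj),
      N ≤ p ∧ N ≤ q ∧ G.Connected ∧ H.Connected ∧
        (GenConn.genConn 3 (SimpleGraph.boxProd G H) : ℤ) = GenConn.upperBound G H) := by
  classical
  refine ⟨fun G H _ _ hG hH hne => genConn_boxProd_le_upperBound hG hH hne, fun N => ?_⟩
  exact ⟨N + 6, N + 6, pendantComplete (N + 6), pendantComplete (N + 6), inferInstance,
    inferInstance, by omega, by omega, pendantComplete_connected, pendantComplete_connected,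
    genConn_pendantProd_eq_upperBound N⟩
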